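/- All graphs are simple and may have arbitrary (finite or infinite) cardinality; classes of graphs are closed under isomorphism. A partition of a set $V$ is a function $\pi : V \to \{0,1\}$. Given a graph $G=(V,E)$ and a partition $\pi$ of $V$, a vertex $x$ is happy in $\pi$ if the cardinal number of neighbours $y$ of $x$ with $\pi(y)\neq\pi(x)$ is at least the cardinal number of neighbours $y$ of $x$ with $\pi(y)=\pi(x)$. The graph $G$ is pre-partitionable if for every $U\subseteq V$ and every partition $\pi$ of $U$ there is a partition $\pi'$ of $V$ extending $\pi$ such that every vertex in $V\setminus U$ is happy in $\pi'$. A class $\mathcal U$ of graphs is finitely closed if the disjoint union of any two graphs in $\mathcal U$ lies in $\mathcal U$, and every graph obtained from a graph in $\mathcal U$ by adding finitely many new vertices and joining them arbitrarily to each other and to the old vertices lies in $\mathcal U$. For a finitely closed class $\mathcal U$, define classes $\mathcal U(\mu)$ recursively for all ordinals $\mu$: let $\mathcal U(0)=\mathcal U$, and for $\mu>0$ let $\mathcal U(\mu)$ be the class of those graphs $G$ that have a finite set $S$ of vertices such that for every component $C$ of $G-S$ there is an ordinal $\lambda<\mu$ with $C\in\mathcal U(\lambda)$. The closure $\overline{\mathcal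 U}$ is the union of the classes $\mathcal U(\mu)$ over all ordinals $\mu$. Theorem. Let $\mathcal U$ be a finitely closed class of graphs. If every graph in $\mathcal U$ is pre-partitionable, then every graph in $\overline{\mathcal U}$ is pre-partitionable. -/

import Mathlib

universe u

namespace UnfriendlyPartition

/-- `x` is happy in the partition `π` if it has at least as many opponents (neighbours in the other
partition class) as friends (neighbours in its own class), counted as cardinal numbers. -/
def Happy {V : Type u} (G : SimpleGraph V) (π : V → Bool) (x : V) : Prop :=
  Cardinal.mk {y : V // G.Adj x y ∧ π y = π x} ≤ Cardinal.mk {y : V // G.Adj x y ∧ π y ≠ π x}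

/-- Every partition `π` of a set `U` of vertices extends to a partition `π'` of the whole graph in
which all vertices outside `U` are happy. -/
def PrePartitionable {V : Type u} (G : SimpleGraph V) : Prop :=
  ∀ (U : Set V) (π : U → Bool), ∃ π' : V → Bool,
    (∀ x : U, π' x = π x) ∧ ∀ x : V, x ∉ U → Happy G π' x

/-- A class of (simple) graphs, of arbitrary cardinality. -/
abbrev GraphClass : Type (u + 1) := ∀ V : Type u, SimpleGraph V → Prop

/-- A class of graphs is finitely closed if it is closed under disjoint unions (of two, hence of
finitely many, of its members) and under adding finitely many new vertices, joined arbitrarily to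
each other and to the old vertices. Graphs are considered up to isomorphism: the second
condition with `S = ∅` contains closure under isomorphism. -/
structure FinitelyClosed (𝒰 : GraphClass.{u}) : Prop where
  disjoint_union : ∀ (V W : Type u) (G : SimpleGraph V) (H : SimpleGraph W),
    𝒰 V G → 𝒰 W H → 𝒰 (V ⊕ W) (G ⊕g H)
  add_vertices : ∀ (V W : Type u) (G : SimpleGraph V) (K : SimpleGraph W) (S : Set W),
    S.Finite → Nonempty (K.induce Sᶜ ≃g G) → 𝒰 V G → 𝒰 W K

/-- The classes `𝒰(μ)`: `𝒰(0) = 𝒰`, and for `μ > 0` a graph `G` is in `𝒰(μ)` if it has a finite set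
`S` of vertices such that every component of `G - S` lies in `𝒰(ν)` for some `ν < μ`. -/
def Level (𝒰 : GraphClass.{u}) (μ : Ordinal.{u}) (V : Type u) (G : SimpleGraph V) : Prop :=
  (μ = 0 ∧ 𝒰 V G) ∨
  (μ ≠ 0 ∧ ∃ S : Set V, S.Finite ∧ ∀ C : (G.induce Sᶜ).ConnectedComponent,
    ∃ ν : Ordinal.{u}, ∃ _ : ν < μ, Level 𝒰 ν _ C.toSimpleGraph)
termination_by μ

/-- The closure of `𝒰`: the union of the classes `𝒰(μ)` over all ordinals `μ`. -/
def Closure (𝒰 : GraphClass.{u}) : GraphClass.{u} :=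
  fun V G => ∃ μ : Ordinal.{u}, Level 𝒰 μ V G

end UnfriendlyPartition

/-!
The theorem is proved by induction on the level. A graph `G` of positive level has a finite set `S`
such that the components of `G - S` have smaller level. Finitely many of these components together
with `S` have smaller level again (`exists_level_union`) or form a finite graph, so they induce a
pre-partitionable graph. It remains to see that a graph `G` glued in this way from pieces along a
finite set `S` is pre-partitionable (`IsGlued.prePartitionable`).

Once the partition of `S` is fixed, the pieces can be treated independently, and each has an
admissible partition, one that makes its own vertices happy. What matters is to choose the partition
of `S`, and admissible partitions of the pieces, so that the vertices of `S` are happy too. There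
are only finitely many partitions of `S`, so each bad one can be excluded by finitely many pieces:
a happy partition of the graph formed by `S` and all these pieces induces a good partition of `S`.
For a good partition, every vertex of `S` of infinite degree `κ` can obtain `κ` opponents from
suitable pieces, and all these demands can be assigned to different pieces
(`exists_transversal_sigma`, `Good.exists_partition`).

Vertices of different infinite degrees would disturb each other in this argument. They are separated
by recolouring (`exists_recolor`): if the only unhappy vertices are at most `λ` vertices
of degree at most `λ`, where `λ` is infinite, then they can be repaired by recolouring at most `λ`
vertices, all of degree at most `λ`, and vertices with more than `λ` opponents do not notice. Hence
it suffices to treat the vertices of `S` of maximum degree `κ`; the others are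
dealt with by induction on the number of vertices of `S` whose colour is not prescribed
(`Extends.of_small_degree`). The same induction treats those vertices of degree `κ` whose
degrees into single pieces are not bounded below `κ`: they are coloured first, and later changes of
the colours of other vertices of `S` cost them fewer than `κ` opponents in each piece
(`Adm.exists_adm_change`). If the degrees into the pieces are bounded below `κ`, then a vertex has
neighbours in `κ` pieces and finds an opponent in `κ` of them (`IsGlued.exists_many_opp_pieces`).
-/

namespace UnfriendlyPartition

open Cardinal

/-! ### Systems of distinct representatives -/

theorem exists_transversal_of_wf {ι α : Type u} (r : ι → ι → Prop) (hr : WellFounded r)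
    (A : ι → Set α) (hA : ∀ i, #{j // r j i} < #(A i)) :
    ∃ f : ι → α, (∀ i, f i ∈ A i) ∧ ∀ i j, r j i → f j ≠ f i := by
  have key : ∀ (i : ι) (g : ∀ j, r j i → α), ∃ a ∈ A i, ∀ j (h : r j i), g j h ≠ a := by
    intro i g
    by_contra! hcon
    refine absurd (hA i) (not_lt.2 ?_)
    have hsub : A i ⊆ Set.range fun j : {j // r j i} => g j.1 j.2 := by
      intro a ha
      obtain ⟨j, hj, e⟩ := hcon a ha
      exact ⟨⟨j, hj⟩, e⟩
    exact (mk_le_mk_of_subset hsub).trans mk_range_le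
  choose F hF using key
  refine ⟨hr.fix F, fun i => ?_, fun i j hji => ?_⟩
  · rw [hr.fix_eq]; exact (hF i _).1
  · rw [hr.fix_eq F i]; exact (hF i fun j _ => hr.fix F j).2 j hji

/-- Finitely many families of sets, each family infinite and indexed by at most as many indices as
each of its sets has elements, have a common system of distinct representatives. The
representatives are chosen by recursion along a well-order of the disjoint union of the index
types that compares first the positions in shortest well-orders of the single index types: then
every index has fewer predecessors than its set has elements. -/
theorem exists_transversal_sigma {T α : Type u} [Finite T] (R : T → Type u)
    (A : ∀ t, R t → Set α) (hR : ∀ t, ℵ₀ ≤ #(R t)) (hA : ∀ t r, #(R t) ≤ #(A t r)) :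
    ∃ f : (Σ t, R t) → α, (∀ i, f i ∈ A i.1 i.2) ∧ Function.Injective f := by
  choose s hs ho using fun t => exists_ord_eq (R t)
  obtain ⟨n, ⟨e⟩⟩ := Finite.exists_equiv_fin T
  let k : (Σ t, R t) → Ordinal.{u} := fun i => Ordinal.typein (s i.1) i.2
  let g : (Σ t, R t) → Ordinal.{u} × Fin n := fun i => (k i, e i.1)
  have hg : Function.Injective g := by
    rintro ⟨t, a⟩ ⟨t', a'⟩ h
    simp only [g, k, Prod.mk.injEq] at h
    obtain rfl := e.injective h.2
    obtain rfl := (Ordinal.typein_inj (s t)).1 h.1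
    rfl
  let r : (Σ t, R t) → (Σ t, R t) → Prop := InvImage (Prod.Lex (· < ·) (· < ·)) g
  have hr : WellFounded r := InvImage.wf _ (WellFounded.prod_lex wellFounded_lt wellFounded_lt)
  have htri : ∀ i j, i ≠ j → r i j ∨ r j i := by
    intro i j hij
    have h1 := fun h => hij (hg h)
    simp only [r, InvImage, Prod.lex_def]
    rcases lt_trichotomy (g i).1 (g j).1 with h | h | h
    · exact Or.inl (Or.inl h)
    · rcases lt_trichotomy (g i).2 (g j).2 with h' | h' | h'
      · exact Or.inl (Or.inr ⟨h, h'⟩)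
      · exact absurd (Prod.ext h h') h1
      · exact Or.inr (Or.inr ⟨h.symm, h'⟩)
    · exact Or.inr (Or.inl h)
  have hcard : ∀ i, #{j // r j i} < #(A i.1 i.2) := by
    rintro ⟨t, a⟩
    refine lt_of_lt_of_le ?_ (hA t a)
    have hk : k ⟨t, a⟩ < (#(R t)).ord := by
      rw [ho t]; exact Ordinal.typein_lt_type _ _
    have hk' : Order.succ (k ⟨t, a⟩) < (#(R t)).ord := (isSuccLimit_ord (hR t)).succ_lt hk
    have hle : #{j // r j ⟨t, a⟩} ≤ #(T × (Order.succ (k ⟨t, a⟩)).ToType) := by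
      have hlt : ∀ j : {j // r j ⟨t, a⟩}, k j.1 < Order.succ (k ⟨t, a⟩) := by
        rintro ⟨j, hj⟩
        rw [Order.lt_succ_iff]
        simp only [r, InvImage, Prod.lex_def] at hj
        rcases hj with h | h
        · exact h.le
        · exact h.1.le
      refine mk_le_of_injective (f := fun j => (j.1.1, Ordinal.ToType.mk ⟨k j.1, hlt j⟩)) ?_
      intro j j' h
      simp only [Prod.mk.injEq, EmbeddingLike.apply_eq_iff_eq] at h
      exact Subtype.ext (hg (Prod.ext (congrArg Subtype.val h.2) (congrArg e h.1)))
    refine hle.trans_lt ?_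
    rw [mk_prod, lift_id, lift_id, mk_toType]
    exact mul_lt_of_lt (hR t) ((lt_aleph0_of_finite T).trans_le (hR t)) (lt_ord.1 hk')
  obtain ⟨f, hf, hne⟩ := exists_transversal_of_wf r hr (fun i => A i.1 i.2) hcard
  refine ⟨f, hf, fun i j hij => ?_⟩
  by_contra hc
  rcases htri i j hc with h | h
  · exact hne _ _ h hij
  · exact hne _ _ h hij.symm

/-! ### Happiness -/

/-- The set of opponents of `x` in `π`. -/
def oppSet {V : Type u} (G : SimpleGraph V) (π : V → Bool) (x : V) : Set V :=
  {y | G.Adj x y ∧ π y ≠ π x}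

theorem oppSet_subset {V : Type u} (G : SimpleGraph V) (π : V → Bool) (x : V) :
    oppSet G π x ⊆ G.neighborSet x := fun _ h => h.1

theorem happy_of_le {V : Type u} {G : SimpleGraph V} {π : V → Bool} {x : V}
    (h : #(G.neighborSet x) ≤ #(oppSet G π x)) : Happy G π x :=
  (mk_le_mk_of_subset (s := {y | G.Adj x y ∧ π y = π x}) (t := G.neighborSet x)
    fun _ hy => hy.1).trans h

theorem neighborSet_subset_union {V : Type u} (G : SimpleGraph V) (π : V → Bool) (x : V) :
    G.neighborSet x ⊆ {y | G.Adj x y ∧ π y = π x} ∪ oppSet G π x := by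
  intro y hy
  by_cases h : π y = π x
  · exact Or.inl ⟨hy, h⟩
  · exact Or.inr ⟨hy, h⟩

theorem Happy.le_oppSet {V : Type u} {G : SimpleGraph V} {π : V → Bool} {x : V}
    (h : Happy G π x) (hx : ℵ₀ ≤ #(G.neighborSet x)) :
    #(G.neighborSet x) ≤ #(oppSet G π x) := by
  by_contra! hlt
  have h1 := (mk_le_mk_of_subset (neighborSet_subset_union G π x)).trans (mk_union_le _ _)
  exact absurd h1 (not_le.2 (add_lt_of_lt hx (lt_of_le_of_lt h hlt) hlt))

theorem Happy.congr {V : Type u} {G : SimpleGraph V} {π π' : V → Bool} {x : V}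
    (h : Happy G π x) (hx : π' x = π x) (hN : ∀ y, G.Adj x y → π' y = π y) : Happy G π' x := by
  have h1 : {y | G.Adj x y ∧ π' y = π' x} = {y | G.Adj x y ∧ π y = π x} := by
    ext y; constructor <;> rintro ⟨a, b⟩ <;> refine ⟨a, ?_⟩
    · rw [← hN y a, b, hx]
    · rw [hN y a, b, hx]
  have h2 : {y | G.Adj x y ∧ π' y ≠ π' x} = {y | G.Adj x y ∧ π y ≠ π x} := by
    ext y; constructor <;> rintro ⟨a, b⟩ <;> refine ⟨a, ?_⟩
    · rw [← hN y a, ← hx]; exact b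
    · rw [hN y a, hx]; exact b
  change #{y | G.Adj x y ∧ π' y = π' x} ≤ #{y | G.Adj x y ∧ π' y ≠ π' x}
  rw [h1, h2]; exact h

/-- If a vertex has many opponents in a set `P`, then it keeps many opponents there when fewer of
its neighbours in `P` are recoloured. -/
theorem le_oppSet_inter_of_recolor {V : Type u} {G : SimpleGraph V} {π π' : V → Bool} {x : V}
    {P : Set V} {lam κ : Cardinal.{u}} (hl : ℵ₀ ≤ lam) (hκ : lam < κ)
    (h : κ ≤ #↥(oppSet G π x ∩ P)) (hx : π' x = π x)
    (hd : #{y | y ∈ P ∧ G.Adj x y ∧ π' y ≠ π y} ≤ lam) : κ ≤ #↥(oppSet G π' x ∩ P) := by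
  by_contra! hlt
  have hsub : oppSet G π x ∩ P ⊆
      (oppSet G π' x ∩ P) ∪ {y | y ∈ P ∧ G.Adj x y ∧ π' y ≠ π y} := by
    rintro y ⟨⟨hy, hne⟩, hyP⟩
    by_cases e : π' y = π y
    · exact Or.inl ⟨⟨hy, by rw [e, hx]; exact hne⟩, hyP⟩
    · exact Or.inr ⟨hyP, hy, e⟩
  have h1 := (mk_le_mk_of_subset hsub).trans (mk_union_le _ _)
  exact absurd (h.trans h1)
    (not_le.2 (add_lt_of_lt (hl.trans hκ.le) hlt (hd.trans_lt hκ)))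

theorem Happy.recolor {V : Type u} {G : SimpleGraph V} {π π' : V → Bool} {x : V}
    {lam : Cardinal.{u}} (hl : ℵ₀ ≤ lam) (hκ : lam < #(G.neighborSet x)) (h : Happy G π x)
    (hx : π' x = π x) (hd : #{y | G.Adj x y ∧ π' y ≠ π y} ≤ lam) : Happy G π' x := by
  have h1 := h.le_oppSet (hl.trans hκ.le)
  rw [← Set.inter_univ (oppSet G π x)] at h1
  refine happy_of_le ((le_oppSet_inter_of_recolor hl hκ h1 hx ?_).trans
    (mk_le_mk_of_subset Set.inter_subset_left))
  exact (mk_le_mk_of_subset fun y hy => hy.2).trans hd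

theorem exists_closed_superset {V : Type u} (G : SimpleGraph V) {A : Set V} {lam : Cardinal.{u}}
    (hl : ℵ₀ ≤ lam) (hA : #A ≤ lam) :
    ∃ Z : Set V, A ⊆ Z ∧ #Z ≤ lam ∧
      ∀ z ∈ Z, #(G.neighborSet z) ≤ lam → G.neighborSet z ⊆ Z := by
  let step : Set V → Set V := fun Z => Z ∪ ⋃ z ∈ {z ∈ Z | #(G.neighborSet z) ≤ lam}, G.neighborSet z
  obtain ⟨Zs, h0, hs⟩ : ∃ Zs : ℕ → Set V, Zs 0 = A ∧ ∀ n, Zs (n + 1) = step (Zs n) :=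
    ⟨fun n => step^[n] A, rfl, fun n => Function.iterate_succ_apply' step n A⟩
  have hc : ∀ n, #(Zs n) ≤ lam := by
    intro n
    induction n with
    | zero => rw [h0]; exact hA
    | succ n ih =>
      rw [hs]
      refine (mk_union_le _ _).trans (add_le_of_le hl ih ?_)
      refine (mk_biUnion_le _ _).trans ?_
      refine (mul_le_mul' ((mk_le_mk_of_subset (Set.sep_subset _ _)).trans ih)
        (ciSup_le' fun z => z.2.2)).trans (mul_eq_self hl).le
  refine ⟨⋃ n : ULift.{u} ℕ, Zs n.down, fun a ha => Set.mem_iUnion.2 ⟨⟨0⟩, h0 ▸ ha⟩, ?_, ?_⟩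
  · refine (mk_iUnion_le _).trans ?_
    refine (mul_le_mul' ?_ (ciSup_le' fun n : ULift.{u} ℕ => hc n.down)).trans (mul_eq_self hl).le
    simpa using hl
  · intro z hz hd y hy
    obtain ⟨n, hn⟩ := Set.mem_iUnion.1 hz
    refine Set.mem_iUnion.2 ⟨⟨n.down + 1⟩, ?_⟩
    change y ∈ Zs (n.down + 1)
    rw [hs n.down]
    exact Or.inr (Set.mem_biUnion (x := z) ⟨hn, hd⟩ hy)

/-- The recolouring principle. Suppose that in `π` the only unhappy vertices of `M` are at most
`lam` vertices of degree at most `lam`. If sets of vertices of degree at most `lam` in `M` can be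
made happy by recolouring just these sets, then all of `M` can be made happy by recolouring at most
`lam` vertices of `M`. The recoloured vertices are those of small degree in a set which is closed
under taking neighbours of vertices of small degree: the other vertices of this set have too large a
degree to notice the change, and vertices outside it are not adjacent to recoloured ones. -/
theorem exists_recolor {V : Type u} {G : SimpleGraph V} {M A : Set V} {lam : Cardinal.{u}}
    (hl : ℵ₀ ≤ lam) (hA : #A ≤ lam) (π : V → Bool)
    (hM : ∀ x ∈ M, Happy G π x ∨ (x ∈ A ∧ #(G.neighborSet x) ≤ lam))
    (hext : ∀ N ⊆ M, (∀ x ∈ N, #(G.neighborSet x) ≤ lam) →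
      ∃ π' : V → Bool, (∀ x ∉ N, π' x = π x) ∧ ∀ x ∈ N, Happy G π' x) :
    ∃ π' : V → Bool, (∀ x ∉ M, π' x = π x) ∧ #{x | π' x ≠ π x} ≤ lam ∧
      ∀ x ∈ M, Happy G π' x := by
  obtain ⟨Z, hAZ, hZ, hcl⟩ := exists_closed_superset G hl hA
  obtain ⟨π', h1, h2⟩ := hext {x ∈ M | x ∈ Z ∧ #(G.neighborSet x) ≤ lam} (fun x hx => hx.1)
    (fun x hx => hx.2.2)
  have hsub : {x | π' x ≠ π x} ⊆ Z := by
    intro x hx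
    by_contra hxZ
    exact hx (h1 x fun h => hxZ h.2.1)
  refine ⟨π', fun x hx => h1 x fun h => hx h.1, (mk_le_mk_of_subset hsub).trans hZ, ?_⟩
  intro x hx
  by_cases hd : #(G.neighborSet x) ≤ lam
  · by_cases hxZ : x ∈ Z
    · exact h2 x ⟨hx, hxZ, hd⟩
    · rcases hM x hx with h | h
      · refine h.congr (h1 x fun h => hxZ h.2.1) fun y hy => h1 y fun hy' => hxZ ?_
        exact hcl y hy'.2.1 hy'.2.2 hy.symm
      · exact absurd (hAZ h.1) hxZ
  · rcases hM x hx with h | h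
    · refine h.recolor hl (not_le.1 hd) (h1 x fun h => hd h.2.2) ?_
      exact (mk_le_mk_of_subset fun y hy => hsub hy.2).trans hZ
    · exact absurd h.2 hd

/-! ### Finite graphs -/

section Finite

open Classical in
/-- The number of ordered pairs of opponents is the number of those avoiding `x` plus twice the
number of opponents of `x`. -/
theorem card_crossing_eq {V : Type u} [Fintype V] (G : SimpleGraph V) (π : V → Bool) (x : V) :
    (Finset.univ.filter fun p : V × V => G.Adj p.1 p.2 ∧ π p.1 ≠ π p.2).card =
      (Finset.univ.filter fun p : V × V =>
        (G.Adj p.1 p.2 ∧ π p.1 ≠ π p.2) ∧ p.1 ≠ x ∧ p.2 ≠ x).card +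
      2 * (Finset.univ.filter fun y : V => G.Adj x y ∧ π y ≠ π x).card := by
  set O := Finset.univ.filter fun y : V => G.Adj x y ∧ π y ≠ π x
  have h1 : (Finset.univ.filter fun p : V × V => G.Adj p.1 p.2 ∧ π p.1 ≠ π p.2) =
      (Finset.univ.filter fun p : V × V =>
        (G.Adj p.1 p.2 ∧ π p.1 ≠ π p.2) ∧ p.1 ≠ x ∧ p.2 ≠ x) ∪
      (O.image (fun y => (x, y)) ∪ O.image (fun y => (y, x))) := by
    ext ⟨a, b⟩
    simp only [O, Finset.mem_filter, Finset.mem_univ, true_and, Finset.mem_union, Finset.mem_image,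
      Prod.mk.injEq]
    constructor
    · rintro ⟨h, hne⟩
      by_cases ha : a = x
      · subst ha; exact Or.inr (Or.inl ⟨b, ⟨h, fun e => hne e.symm⟩, rfl, rfl⟩)
      · by_cases hb : b = x
        · subst hb; exact Or.inr (Or.inr ⟨a, ⟨h.symm, hne⟩, rfl, rfl⟩)
        · exact Or.inl ⟨⟨h, hne⟩, ha, hb⟩
    · rintro (h | ⟨y, ⟨h, hne⟩, rfl, rfl⟩ | ⟨y, ⟨h, hne⟩, rfl, rfl⟩)
      · exact h.1
      · exact ⟨h, fun e => hne e.symm⟩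
      · exact ⟨h.symm, hne⟩
  rw [h1, Finset.card_union_of_disjoint, Finset.card_union_of_disjoint,
    Finset.card_image_of_injective _ (Prod.mk_right_injective x),
    Finset.card_image_of_injective _ (Prod.mk_left_injective x), two_mul]
  · rw [Finset.disjoint_left]
    simp only [O, Finset.mem_filter, Finset.mem_univ, true_and, Finset.mem_image, not_exists,
      not_and, forall_exists_index, and_imp]
    rintro _ y hy _ rfl z hz _ e
    obtain ⟨rfl, rfl⟩ := Prod.mk.inj e
    exact hy.ne rfl
  · rw [Finset.disjoint_left]
    simp only [O, Finset.mem_filter, Finset.mem_univ, true_and, Finset.mem_union, Finset.mem_image]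
    rintro p ⟨_, h1, h2⟩ (⟨y, _, rfl⟩ | ⟨y, _, rfl⟩)
    · exact h1 rfl
    · exact h2 rfl

open Classical in
/-- Finite graphs: take an extension that maximizes the number of opponent pairs. -/
theorem prePartitionable_of_finite {V : Type u} [Finite V] (G : SimpleGraph V) :
    PrePartitionable G := by
  have := Fintype.ofFinite V
  intro U π
  let f : (V → Bool) → ℕ := fun π =>
    (Finset.univ.filter fun p : V × V => G.Adj p.1 p.2 ∧ π p.1 ≠ π p.2).card
  obtain ⟨π', h1, h2⟩ := Set.exists_max_image {π' : V → Bool | ∀ x : U, π' x = π x} f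
    (Set.toFinite _) ⟨fun x => if h : x ∈ U then π ⟨x, h⟩ else false, fun x => by simp⟩
  refine ⟨π', h1, fun x hx => ?_⟩
  let π'' := Function.update π' x (!π' x)
  have hxx : π'' x = !π' x := Function.update_self ..
  have hne : ∀ y, y ≠ x → π'' y = π' y := fun y hy => Function.update_of_ne hy ..
  have h3 := h2 π'' (fun y => by
    rw [hne _ (fun e => hx (e ▸ y.2))]; exact h1 y)
  simp only [f, card_crossing_eq G π' x, card_crossing_eq G π'' x] at h3
  have h4 : (Finset.univ.filter fun p : V × V =>
        (G.Adj p.1 p.2 ∧ π'' p.1 ≠ π'' p.2) ∧ p.1 ≠ x ∧ p.2 ≠ x) =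
      (Finset.univ.filter fun p : V × V =>
        (G.Adj p.1 p.2 ∧ π' p.1 ≠ π' p.2) ∧ p.1 ≠ x ∧ p.2 ≠ x) := by
    ext p
    simp only [Finset.mem_filter, Finset.mem_univ, true_and, and_congr_left_iff]
    rintro ⟨ha, hb⟩
    rw [hne _ ha, hne _ hb]
  have h5 : (Finset.univ.filter fun y : V => G.Adj x y ∧ π'' y ≠ π'' x) =
      (Finset.univ.filter fun y : V => G.Adj x y ∧ π' y = π' x) := by
    ext y
    simp only [Finset.mem_filter, Finset.mem_univ, true_and, and_congr_right_iff]
    intro h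
    rw [hne y h.ne', hxx]
    cases π' x <;> cases π' y <;> simp
  rw [h4, h5] at h3
  unfold Happy
  rw [mk_fintype, mk_fintype, Fintype.card_subtype, Fintype.card_subtype]
  exact_mod_cast (by omega :
    (Finset.univ.filter fun y : V => G.Adj x y ∧ π' y = π' x).card ≤
    (Finset.univ.filter fun y : V => G.Adj x y ∧ π' y ≠ π' x).card)

end Finite

/-! ### Levels of induced subgraphs -/

/-- The set `A` is nonempty and induces a connected subgraph of `G`, expressed by saying that `A`
lies in every set of vertices that meets `A` and is closed under taking neighbours in `A`. -/
def IsConn {V : Type u} (G : SimpleGraph V) (A : Set V) : Prop :=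
  A.Nonempty ∧ ∀ P : Set V, (∃ x ∈ A, x ∈ P) →
    (∀ x ∈ A, ∀ y ∈ A, x ∈ P → G.Adj x y → y ∈ P) → A ⊆ P

/-- The set `A` is the vertex set of a component of the subgraph of `G` induced by `B`. -/
structure IsComp {V : Type u} (G : SimpleGraph V) (B A : Set V) : Prop where
  subset : A ⊆ B
  conn : IsConn G A
  closed : ∀ x ∈ A, ∀ y ∈ B, G.Adj x y → y ∈ A

theorem isConn_image {V W : Type u} {G : SimpleGraph V} {H : SimpleGraph W} (f : H ↪g G)
    {A : Set W} : IsConn G (f '' A) ↔ IsConn H A := by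
  constructor
  · rintro ⟨h1, h2⟩
    refine ⟨h1.of_image, fun P ⟨x, hx, hxP⟩ hP => ?_⟩
    refine (Set.image_subset_image_iff f.injective).1
      (h2 (f '' P) ⟨f x, ⟨x, hx, rfl⟩, ⟨x, hxP, rfl⟩⟩ ?_)
    rintro _ ⟨a, ha, rfl⟩ _ ⟨b, hb, rfl⟩ haP hadj
    exact ⟨b, hP a ha b hb (f.injective.mem_set_image.1 haP) (f.map_adj_iff.1 hadj), rfl⟩
  · rintro ⟨h1, h2⟩
    refine ⟨h1.image f, ?_⟩
    rintro P ⟨_, ⟨x, hx, rfl⟩, hxP⟩ hP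
    refine Set.image_subset_iff.2 (h2 (f ⁻¹' P) ⟨x, hx, hxP⟩ fun a ha b hb haP hadj => ?_)
    exact hP _ ⟨a, ha, rfl⟩ _ ⟨b, hb, rfl⟩ haP (f.map_adj_iff.2 hadj)

theorem isComp_image {V W : Type u} {G : SimpleGraph V} {H : SimpleGraph W} (f : H ↪g G)
    {A B : Set W} : IsComp G (f '' B) (f '' A) ↔ IsComp H B A := by
  constructor
  · rintro ⟨h1, h2, h3⟩
    refine ⟨(Set.image_subset_image_iff f.injective).1 h1, (isConn_image f).1 h2,
      fun x hx y hy hxy => ?_⟩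
    exact f.injective.mem_set_image.1 (h3 _ ⟨x, hx, rfl⟩ _ ⟨y, hy, rfl⟩ (f.map_adj_iff.2 hxy))
  · rintro ⟨h1, h2, h3⟩
    refine ⟨Set.image_mono h1, (isConn_image f).2 h2, ?_⟩
    rintro _ ⟨x, hx, rfl⟩ _ ⟨y, hy, rfl⟩ hxy
    exact ⟨y, h3 x hx y hy (f.map_adj_iff.1 hxy), rfl⟩

/-- An embedding maps an induced subgraph isomorphically to the subgraph induced by the image. -/
noncomputable def induceImageIso {V W : Type u} {G : SimpleGraph V} {H : SimpleGraph W}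
    (f : H ↪g G) (A : Set W) : H.induce A ≃g G.induce (f '' A) where
  toEquiv := Equiv.Set.image f A f.injective
  map_rel_iff' := by
    intro a b
    exact f.map_adj_iff

theorem IsComp.eq_of_mem {V : Type u} {G : SimpleGraph V} {B A A' : Set V} (h : IsComp G B A)
    (h' : IsComp G B A') {x : V} (hx : x ∈ A) (hx' : x ∈ A') : A = A' :=
  Set.Subset.antisymm
    (h.conn.2 A' ⟨x, hx, hx'⟩ fun a _ b hb ha' hab => h'.closed a ha' b (h.subset hb) hab)
    (h'.conn.2 A ⟨x, hx', hx⟩ fun a _ b hb ha' hab => h.closed a ha' b (h'.subset hb) hab)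

theorem isComp_supp {V : Type u} {G : SimpleGraph V} {B : Set V}
    (C : (G.induce B).ConnectedComponent) : IsComp G B (Subtype.val '' C.supp) := by
  have h : IsComp (G.induce B) Set.univ C.supp := by
    refine ⟨Set.subset_univ _, ⟨C.nonempty_supp, ?_⟩, ?_⟩
    · rintro P ⟨x, hx, hxP⟩ hP y hy
      obtain ⟨w⟩ := SimpleGraph.ConnectedComponent.exact (hx.trans hy.symm)
      clear hy
      induction w with
      | nil => exact hxP
      | cons hadj w ih =>
        have hv := (SimpleGraph.ConnectedComponent.mem_supp_congr_adj C hadj).1 hx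
        exact ih hv (hP _ hx _ hv hxP hadj)
    · intro x hx y _ hxy
      exact (SimpleGraph.ConnectedComponent.mem_supp_congr_adj C hxy).1 hx
  have h2 := (isComp_image (SimpleGraph.Embedding.induce B (G := G))).2 h
  have e : (SimpleGraph.Embedding.induce B (G := G)) '' Set.univ = B := by
    ext x; simp [SimpleGraph.Embedding.induce]
  rw [e] at h2
  exact h2

theorem IsComp.exists_supp {V : Type u} {G : SimpleGraph V} {B A : Set V} (h : IsComp G B A) :
    ∃ C : (G.induce B).ConnectedComponent, Subtype.val '' C.supp = A := by
  obtain ⟨x, hx⟩ := h.conn.1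
  refine ⟨(G.induce B).connectedComponentMk ⟨x, h.subset hx⟩, ?_⟩
  exact (isComp_supp _).eq_of_mem h ⟨⟨x, h.subset hx⟩, rfl, rfl⟩ hx

theorem FinitelyClosed.iso {𝒰 : GraphClass.{u}} (h𝒰 : FinitelyClosed 𝒰) {V W : Type u}
    {G : SimpleGraph V} {H : SimpleGraph W} (e : G ≃g H) (hG : 𝒰 V G) : 𝒰 W H := by
  refine h𝒰.add_vertices V W G H ∅ Set.finite_empty ⟨?_⟩ hG
  rw [Set.compl_empty]
  exact (SimpleGraph.induceUnivIso H).trans e.symm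

/-- Components in the definition of the levels described by their vertex sets, given that lower
levels are closed under isomorphism. -/
theorem level_iff_aux {𝒰 : GraphClass.{u}} {μ : Ordinal.{u}} (hμ : μ ≠ 0)
    (hiso : ∀ ν < μ, ∀ (V W : Type u) (G : SimpleGraph V) (H : SimpleGraph W),
      Nonempty (G ≃g H) → Level 𝒰 ν V G → Level 𝒰 ν W H) {V : Type u} (G : SimpleGraph V) :
    Level 𝒰 μ V G ↔ ∃ S : Set V, S.Finite ∧ ∀ A, IsComp G Sᶜ A →
      ∃ ν < μ, Level 𝒰 ν _ (G.induce A) := by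
  rw [Level.eq_def]
  simp only [hμ, false_and, false_or, ne_eq, not_false_eq_true, true_and, exists_prop]
  refine exists_congr fun S => and_congr_right fun _ => ?_
  have key : ∀ C : (G.induce Sᶜ).ConnectedComponent,
      Nonempty (C.toSimpleGraph ≃g G.induce (Subtype.val '' C.supp)) := fun C =>
    ⟨induceImageIso (SimpleGraph.Embedding.induce Sᶜ (G := G)) C.supp⟩
  constructor
  · intro h A hA
    obtain ⟨C, rfl⟩ := hA.exists_supp
    obtain ⟨ν, hν, hl⟩ := h C
    exact ⟨ν, hν, hiso ν hν _ _ _ _ (key C) hl⟩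
  · intro h C
    obtain ⟨ν, hν, hl⟩ := h _ (isComp_supp C)
    exact ⟨ν, hν, hiso ν hν _ _ _ _ ⟨(key C).some.symm⟩ hl⟩

theorem level_zero {𝒰 : GraphClass.{u}} {V : Type u} {G : SimpleGraph V} :
    Level 𝒰 0 V G ↔ 𝒰 V G := by
  rw [Level.eq_def]; simp

theorem level_iso {𝒰 : GraphClass.{u}} (h𝒰 : FinitelyClosed 𝒰) (μ : Ordinal.{u}) :
    ∀ (V W : Type u) (G : SimpleGraph V) (H : SimpleGraph W),
      Nonempty (G ≃g H) → Level 𝒰 μ V G → Level 𝒰 μ W H := by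
  induction μ using WellFoundedLT.induction with
  | ind μ ih =>
    rintro V W G H ⟨e⟩ hG
    by_cases hμ : μ = 0
    · subst hμ
      exact level_zero.2 (h𝒰.iso e (level_zero.1 hG))
    · rw [level_iff_aux hμ ih] at hG ⊢
      obtain ⟨S, hS, h⟩ := hG
      refine ⟨e '' S, hS.image _, fun A hA => ?_⟩
      have e1 : e '' (e ⁻¹' A) = A := Set.image_preimage_eq _ e.surjective
      have e2 : (e '' S)ᶜ = e '' Sᶜ := (Set.image_compl_eq e.bijective).symm
      rw [← e1, e2] at hA
      obtain ⟨ν, hν, hl⟩ := h (e ⁻¹' A) ((isComp_image e.toEmbedding).1 hA)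
      refine ⟨ν, hν, ih ν hν _ _ _ _ ⟨?_⟩ hl⟩
      have i := induceImageIso e.toEmbedding (e ⁻¹' A)
      have e3 : (e.toEmbedding '' (e ⁻¹' A)) = A := e1
      rw [e3] at i
      exact i

/-- The levels of induced subgraphs in terms of sets of vertices of the ambient graph. -/
theorem level_induce_iff {𝒰 : GraphClass.{u}} (h𝒰 : FinitelyClosed 𝒰) {μ : Ordinal.{u}}
    (hμ : μ ≠ 0) {V : Type u} (G : SimpleGraph V) (B : Set V) :
    Level 𝒰 μ _ (G.induce B) ↔ ∃ S : Set V, S.Finite ∧ ∀ A, IsComp G (B \ S) A →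
      ∃ ν < μ, Level 𝒰 ν _ (G.induce A) := by
  rw [level_iff_aux hμ fun ν _ => level_iso h𝒰 ν]
  let f := SimpleGraph.Embedding.induce B (G := G)
  have hf : ∀ S : Set B, f '' S = Subtype.val '' S := fun S => rfl
  constructor
  · rintro ⟨S, hS, h⟩
    refine ⟨f '' S, hS.image _, fun A hA => ?_⟩
    have e1 : B \ f '' S = f '' Sᶜ := by
      ext x; simp only [hf, Set.mem_sdiff, Set.mem_image, Subtype.exists, Set.mem_compl_iff]
      constructor
      · rintro ⟨hx, hn⟩; exact ⟨x, hx, fun h => hn ⟨x, hx, h, rfl⟩, rfl⟩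
      · rintro ⟨x, hx, hn, rfl⟩
        refine ⟨hx, ?_⟩
        rintro ⟨y, hy, h, rfl⟩; exact hn h
    have e2 : f '' (f ⁻¹' A) = A :=
      Set.image_preimage_eq_of_subset ((hA.subset.trans (e1 ▸ Set.image_subset_range f _)))
    rw [← e2, e1] at hA
    obtain ⟨ν, hν, hl⟩ := h _ ((isComp_image f).1 hA)
    refine ⟨ν, hν, level_iso h𝒰 ν _ _ _ _ ⟨?_⟩ hl⟩
    have i := induceImageIso f (f ⁻¹' A)
    rw [e2] at i
    exact i
  · rintro ⟨S, hS, h⟩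
    refine ⟨f ⁻¹' S, hS.preimage f.injective.injOn, fun A hA => ?_⟩
    have e1 : f '' (f ⁻¹' S)ᶜ = B \ S := by
      ext x; simp only [hf, Set.mem_sdiff, Set.mem_image, Subtype.exists, Set.mem_compl_iff,
        Set.mem_preimage]
      constructor
      · rintro ⟨x, hx, hn, rfl⟩; exact ⟨hx, hn⟩
      · rintro ⟨hx, hn⟩; exact ⟨x, hx, hn, rfl⟩
    have hA' := (isComp_image f).2 hA
    rw [e1] at hA'
    obtain ⟨ν, hν, hl⟩ := h _ hA'
    exact ⟨ν, hν, level_iso h𝒰 ν _ _ _ _ ⟨(induceImageIso f A).symm⟩ hl⟩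

/-- If no edge joins two disjoint sets, then their union induces a disjoint union of graphs. -/
theorem nonempty_sum_iso_induce_union {V : Type u} (G : SimpleGraph V) {A B : Set V}
    (h : ∀ x ∈ A, ∀ y ∈ B, x ≠ y ∧ ¬ G.Adj x y) :
    Nonempty ((G.induce A ⊕g G.induce B) ≃g G.induce (A ∪ B)) := by
  classical
  have hd : Disjoint A B := Set.disjoint_left.2 fun x hx hx' => (h x hx x hx').1 rfl
  refine ⟨⟨(Equiv.Set.union hd).symm, ?_⟩⟩
  rintro (⟨a, ha⟩ | ⟨a, ha⟩) (⟨b, hb⟩ | ⟨b, hb⟩)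
  · simp
  · simpa using (h a ha b hb).2
  · simpa using fun hab : G.Adj a b => (h b hb a ha).2 hab.symm
  · simp

theorem FinitelyClosed.sUnion {𝒰 : GraphClass.{u}} (h𝒰 : FinitelyClosed 𝒰) {V : Type u}
    (G : SimpleGraph V) {𝒜 : Set (Set V)} (hfin : 𝒜.Finite) :
    𝒜.Nonempty → (∀ A ∈ 𝒜, ∀ A' ∈ 𝒜, ∀ x ∈ A, ∀ y ∈ A', (x = y ∨ G.Adj x y) → A = A') →
      (∀ A ∈ 𝒜, 𝒰 _ (G.induce A)) → 𝒰 _ (G.induce (⋃₀ 𝒜)) := by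
  induction 𝒜, hfin using Set.Finite.induction_on with
  | empty => intro h; exact absurd h Set.not_nonempty_empty
  | @insert A 𝒜 hA _ ih =>
    intro _ hsep h
    rcases 𝒜.eq_empty_or_nonempty with rfl | hne
    · have : ⋃₀ (insert A ∅ : Set (Set V)) = A := by simp
      rw [this]
      exact h A (Set.mem_insert _ _)
    · have h1 := ih hne (fun B hB B' hB' => hsep B (Or.inr hB) B' (Or.inr hB'))
        fun B hB => h B (Or.inr hB)
      rw [Set.sUnion_insert]
      obtain ⟨i⟩ := nonempty_sum_iso_induce_union G (A := A) (B := ⋃₀ 𝒜) (by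
        rintro x hx y ⟨B, hB, hy⟩
        have hAB : A ≠ B := fun e => hA (e ▸ hB)
        exact ⟨fun e => hAB (hsep A (Or.inl rfl) B (Or.inr hB) x hx y hy (Or.inl e)),
          fun e => hAB (hsep A (Or.inl rfl) B (Or.inr hB) x hx y hy (Or.inr e))⟩)
      exact h𝒰.iso i (h𝒰.disjoint_union _ _ _ _ (h A (Or.inl rfl)) h1)

/-- Finitely many connected graphs of level less than `μ` together with finitely many additional
vertices form a graph of level less than `μ`: its level is the maximum of the given ones. -/
theorem exists_level_union {𝒰 : GraphClass.{u}} (h𝒰 : FinitelyClosed 𝒰) {μ : Ordinal.{u}}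
    {V : Type u} (G : SimpleGraph V) {S : Set V} (hS : S.Finite) {𝒜 : Set (Set V)}
    (hfin : 𝒜.Finite) (hne : 𝒜.Nonempty)
    (hsep : ∀ A ∈ 𝒜, ∀ A' ∈ 𝒜, ∀ x ∈ A, ∀ y ∈ A', (x = y ∨ G.Adj x y) → A = A')
    (hconn : ∀ A ∈ 𝒜, IsConn G A) (hSA : ∀ A ∈ 𝒜, ∀ x ∈ A, x ∉ S)
    (hl : ∀ A ∈ 𝒜, ∃ ν < μ, Level 𝒰 ν _ (G.induce A)) :
    ∃ ν < μ, Level 𝒰 ν _ (G.induce (S ∪ ⋃₀ 𝒜)) := by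
  classical
  have hl' : ∀ A, ∃ ν, A ∈ 𝒜 → ν < μ ∧ Level 𝒰 ν _ (G.induce A) := by
    intro A
    by_cases hA : A ∈ 𝒜
    · obtain ⟨ν, h⟩ := hl A hA; exact ⟨ν, fun _ => h⟩
    · exact ⟨0, fun h => absurd h hA⟩
  choose lv hlv using hl'
  obtain ⟨A₀, hA₀, hmax⟩ := Set.exists_max_image 𝒜 lv hfin hne
  refine ⟨lv A₀, (hlv A₀ hA₀).1, ?_⟩
  by_cases h0 : lv A₀ = 0
  · rw [h0, level_zero]
    have h1 : 𝒰 _ (G.induce (⋃₀ 𝒜)) := h𝒰.sUnion G hfin hne hsep fun A hA => by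
      have := (hlv A hA).2
      have h2 := hmax A hA
      rw [h0, nonpos_iff_eq_zero] at h2
      rwa [h2, level_zero] at this
    let f := SimpleGraph.Embedding.induce (S ∪ ⋃₀ 𝒜) (G := G)
    refine h𝒰.add_vertices _ _ _ _ {x | x.1 ∉ ⋃₀ 𝒜} ?_ ⟨?_⟩ h1
    · refine (hS.preimage f.injective.injOn).subset fun x hx => ?_
      exact x.2.resolve_right hx
    · have i := induceImageIso f {x | x.1 ∉ ⋃₀ 𝒜}ᶜ
      have e : f '' {x | x.1 ∉ ⋃₀ 𝒜}ᶜ = ⋃₀ 𝒜 := by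
        ext x
        constructor
        · rintro ⟨y, hy, rfl⟩; exact not_not.1 hy
        · intro hx; exact ⟨⟨x, Or.inr hx⟩, not_not.2 hx, rfl⟩
      rw [e] at i
      exact i
  · have hK : ∀ A, ∃ K : Set V, K.Finite ∧ (A ∈ 𝒜 → lv A ≠ 0 →
        ∀ A', IsComp G (A \ K) A' → ∃ ν < lv A, Level 𝒰 ν _ (G.induce A')) := by
      intro A
      by_cases hA : A ∈ 𝒜 ∧ lv A ≠ 0
      · obtain ⟨K, hK, h⟩ := (level_induce_iff h𝒰 hA.2 G A).1 (hlv A hA.1).2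
        exact ⟨K, hK, fun _ _ => h⟩
      · exact ⟨∅, Set.finite_empty, fun h h' => absurd ⟨h, h'⟩ hA⟩
    choose K hKf hK using hK
    refine (level_induce_iff h𝒰 h0 G _).2
      ⟨S ∪ ⋃ A ∈ {A ∈ 𝒜 | lv A ≠ 0}, K A ∩ A,
        hS.union ((hfin.subset (Set.sep_subset _ _)).biUnion fun A _ =>
          (hKf A).subset Set.inter_subset_left), ?_⟩
    intro A' hA'
    obtain ⟨x, hx⟩ := hA'.conn.1
    have hxA : ∀ y ∈ A', ∃ A ∈ 𝒜, y ∈ A := fun y hy =>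
      (hA'.subset hy).1.resolve_left fun h => (hA'.subset hy).2 (Or.inl h)
    obtain ⟨A, hA, hxA'⟩ := hxA x hx
    have hsubA : A' ⊆ A := hA'.conn.2 A ⟨x, hx, hxA'⟩ fun a _ b hb haA hab => by
      obtain ⟨B, hB, hbB⟩ := hxA b hb
      rw [hsep A hA B hB a haA b hbB (Or.inr hab)]
      exact hbB
    have hmem : ∀ y ∈ A, y ∉ K A ∨ lv A = 0 → y ∈ (S ∪ ⋃₀ 𝒜) \
        (S ∪ ⋃ A ∈ {A ∈ 𝒜 | lv A ≠ 0}, K A ∩ A) := by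
      intro y hy hyK
      refine ⟨Or.inr ⟨A, hA, hy⟩, ?_⟩
      rintro (h | h)
      · exact hSA A hA y hy h
      · obtain ⟨B, ⟨hB, hB0⟩, hyKB, hyB⟩ := Set.mem_iUnion₂.1 h
        obtain rfl := hsep A hA B hB y hy y hyB (Or.inl rfl)
        exact hyK.elim (fun h => h hyKB) hB0
    by_cases hA0 : lv A = 0
    · -- no vertex of a part of level `0` has been deleted, so such a part is a component
      have e : A' = A := hsubA.antisymm ((hconn A hA).2 A' ⟨x, hxA', hx⟩
        fun a _ b hb ha' hab => hA'.closed a ha' b (hmem b hb (Or.inr hA0)) hab)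
      subst e
      exact ⟨lv A', hA0 ▸ pos_iff_ne_zero.2 h0, (hlv A' hA).2⟩
    · have hcomp : IsComp G (A \ K A) A' := by
        refine ⟨fun y hy => ⟨hsubA hy, fun hyK => (hA'.subset hy).2 (Or.inr ?_)⟩, hA'.conn,
          fun a ha b hb hab => hA'.closed a ha b (hmem b hb.1 (Or.inl hb.2)) hab⟩
        exact Set.mem_biUnion (x := A) ⟨hA, hA0⟩ ⟨hyK, hsubA hy⟩
      obtain ⟨ν, hν, hlν⟩ := hK A hA hA0 A' hcomp
      exact ⟨ν, hν.trans_le (hmax A hA), hlν⟩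

/-- A graph of positive level is glued along a finite set `S` from pieces, the fibres of `c` outside
`S`, with no edges between different pieces; finitely many of these pieces together with `S` form a
pre-partitionable graph, since it has smaller level or is finite. -/
theorem Level.exists_pieces {𝒰 : GraphClass.{u}} (h𝒰 : FinitelyClosed 𝒰) {μ : Ordinal.{u}}
    (hμ : μ ≠ 0) (ih : ∀ ν < μ, ∀ (V : Type u) (G : SimpleGraph V), Level 𝒰 ν V G →
      PrePartitionable G) {V : Type u} (G : SimpleGraph V) (hG : Level 𝒰 μ V G) :
    ∃ (S : Set V) (c : V → Set V), S.Finite ∧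
      (∀ x y, x ∉ S → y ∉ S → G.Adj x y → c x = c y) ∧
      ∀ X : Set (Set V), X.Finite →
        PrePartitionable (G.induce (S ∪ {x | x ∉ S ∧ c x ∈ X})) := by
  classical
  obtain ⟨S, hS, h⟩ := (level_iff_aux hμ (fun ν _ => level_iso h𝒰 ν) G).1 hG
  let c : V → Set V := fun x =>
    if hx : x ∈ Sᶜ then Subtype.val '' ((G.induce Sᶜ).connectedComponentMk ⟨x, hx⟩).supp else ∅
  have hc : ∀ x, x ∉ S → IsComp G Sᶜ (c x) := fun x hx => by
    simp only [c, dif_pos (show x ∈ Sᶜ from hx)]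
    exact isComp_supp _
  have hxc : ∀ x, x ∉ S → x ∈ c x := fun x hx => by
    simp only [c, dif_pos (show x ∈ Sᶜ from hx)]
    exact ⟨⟨x, hx⟩, rfl, rfl⟩
  have hadj : ∀ x y, x ∉ S → y ∉ S → G.Adj x y → c x = c y := fun x y hx hy hxy =>
    (hc x hx).eq_of_mem (hc y hy) ((hc x hx).closed x (hxc x hx) y hy hxy) (hxc y hy)
  refine ⟨S, c, hS, hadj, fun X hX => ?_⟩
  let 𝒜 : Set (Set V) := X ∩ c '' Sᶜ
  have h𝒜 : ∀ A ∈ 𝒜, IsComp G Sᶜ A := by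
    rintro _ ⟨_, x, hx, rfl⟩; exact hc x hx
  have e : S ∪ {x | x ∉ S ∧ c x ∈ X} = S ∪ ⋃₀ 𝒜 := by
    congr 1
    ext x
    constructor
    · rintro ⟨hx, hX⟩; exact ⟨c x, ⟨hX, x, hx, rfl⟩, hxc x hx⟩
    · rintro ⟨A, hA, hxA⟩
      have hxS : x ∉ S := (h𝒜 A hA).subset hxA
      exact ⟨hxS, (h𝒜 A hA).eq_of_mem (hc x hxS) hxA (hxc x hxS) ▸ hA.1⟩
  rw [e]
  rcases 𝒜.eq_empty_or_nonempty with h0 | hne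
  · rw [h0, Set.sUnion_empty, Set.union_empty]
    have := hS.to_subtype
    exact prePartitionable_of_finite _
  · obtain ⟨ν, hν, hl⟩ := exists_level_union h𝒰 G hS (hX.subset Set.inter_subset_left) hne
      (fun A hA A' hA' x hx y hy hxy => by
        refine (h𝒜 A hA).eq_of_mem (h𝒜 A' hA') (x := y) ?_ hy
        rcases hxy with rfl | hxy
        · exact hx
        · exact (h𝒜 A hA).closed x hx y ((h𝒜 A' hA').subset hy) hxy)
      (fun A hA => (h𝒜 A hA).conn) (fun A hA x hx => (h𝒜 A hA).subset hx)
      (fun A hA => h A (h𝒜 A hA))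
    exact ih ν hν _ _ hl

/-! ### Gluing along a finite set -/

theorem mk_iUnion_lt_of_finite {ι α : Type u} [Finite ι] (A : ι → Set α) {κ : Cardinal.{u}}
    (hκ : ℵ₀ ≤ κ) (h : ∀ i, #(A i) < κ) : #(⋃ i, A i) < κ := by
  rcases isEmpty_or_nonempty ι with hι | hι
  · simpa using aleph0_pos.trans_le hκ
  · obtain ⟨i, hi⟩ := Finite.exists_max fun i => #(A i)
    refine (mk_iUnion_le A).trans_lt ?_
    exact mul_lt_of_lt hκ ((lt_aleph0_of_finite ι).trans_le hκ)
      ((ciSup_le' hi).trans_lt (h i))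

theorem mk_biUnion_lt_of_finite {ι α : Type u} {X : Set ι} (hX : X.Finite) (A : ι → Set α)
    {κ : Cardinal.{u}} (hκ : ℵ₀ ≤ κ) (h : ∀ i ∈ X, #(A i) < κ) : #(⋃ i ∈ X, A i) < κ := by
  have := hX.to_subtype
  rw [Set.biUnion_eq_iUnion]
  exact mk_iUnion_lt_of_finite _ hκ fun i => h i i.2

/-- Finitely many conditions, each satisfied by all large cardinals below `κ`, are satisfied by a
common infinite cardinal below `κ`. -/
theorem exists_uniform_bound {α : Type u} {S : Set α} (hS : S.Finite) {κ : Cardinal.{u}}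
    (hκ : ℵ₀ < κ) (P : α → Cardinal.{u} → Prop) (hP : ∀ s ∈ S, ∃ l < κ, P s l)
    (hmono : ∀ s l l', l ≤ l' → P s l → P s l') :
    ∃ l, ℵ₀ ≤ l ∧ l < κ ∧ ∀ s ∈ S, P s l := by
  induction S, hS using Set.Finite.induction_on with
  | empty => exact ⟨ℵ₀, le_rfl, hκ, fun s h => absurd h (Set.notMem_empty s)⟩
  | @insert a S _ _ ih =>
    obtain ⟨l, h1, h2, h3⟩ := ih fun s hs => hP s (Or.inr hs)
    obtain ⟨l', h4, h5⟩ := hP a (Or.inl rfl)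
    refine ⟨max l l', h1.trans (le_max_left _ _), max_lt h2 h4, ?_⟩
    rintro s (rfl | hs)
    · exact hmono _ _ _ (le_max_right _ _) h5
    · exact hmono _ _ _ (le_max_left _ _) (h3 s hs)

/-- The piece with index `i`: the vertices outside `S` that `c` maps to `i`. -/
def piece {V I : Type u} (S : Set V) (c : V → I) (i : I) : Set V := {x | x ∉ S ∧ c x = i}

/-- The set `S` together with the pieces whose index lies in `X`. -/
def pieces {V I : Type u} (S : Set V) (c : V → I) (X : Set I) : Set V :=
  S ∪ {x | x ∉ S ∧ c x ∈ X}

/-- The graph `G` is glued along the finite set `S` from the fibres of `c` outside `S`: different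
pieces are not adjacent, and finitely many pieces together with `S` induce a pre-partitionable
graph. -/
structure IsGlued {V I : Type u} (G : SimpleGraph V) (S : Set V) (c : V → I) : Prop where
  finite : S.Finite
  eq_of_adj : ∀ x y, x ∉ S → y ∉ S → G.Adj x y → c x = c y
  pre : ∀ X : Set I, X.Finite → PrePartitionable (G.induce (pieces S c X))

/-- The vertex `x` is happy in the subgraph of `G` induced by `B`. -/
def HappyIn {V : Type u} (G : SimpleGraph V) (B : Set V) (π : V → Bool) (x : V) : Prop :=
  #{y | y ∈ B ∧ G.Adj x y ∧ π y = π x} ≤ #{y | y ∈ B ∧ G.Adj x y ∧ π y ≠ π x}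

theorem HappyIn.happy {V : Type u} {G : SimpleGraph V} {B : Set V} {π : V → Bool} {x : V}
    (h : HappyIn G B π x) (hB : G.neighborSet x ⊆ B) : Happy G π x := by
  have e : ∀ p : V → Prop, {y | y ∈ B ∧ G.Adj x y ∧ p y} = {y | G.Adj x y ∧ p y} := fun p => by
    ext y
    exact ⟨fun h => h.2, fun h => ⟨hB h.1, h⟩⟩
  unfold HappyIn at h
  rw [e, e] at h
  exact h

theorem HappyIn.le_opp {V : Type u} {G : SimpleGraph V} {B : Set V} {π : V → Bool} {x : V}
    {m : Cardinal.{u}} (h : HappyIn G B π x) (hm : ℵ₀ ≤ m) (hB : m ≤ #↥(G.neighborSet x ∩ B)) :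
    m ≤ #↥(oppSet G π x ∩ B) := by
  by_contra! hlt
  have hsub : G.neighborSet x ∩ B ⊆
      {y | y ∈ B ∧ G.Adj x y ∧ π y = π x} ∪ (oppSet G π x ∩ B) := by
    rintro y ⟨hy, hyB⟩
    by_cases e : π y = π x
    · exact Or.inl ⟨hyB, hy, e⟩
    · exact Or.inr ⟨⟨hy, e⟩, hyB⟩
  have hle : #{y | y ∈ B ∧ G.Adj x y ∧ π y = π x} ≤ #↥(oppSet G π x ∩ B) :=
    h.trans (mk_le_mk_of_subset fun y hy => ⟨hy.2, hy.1⟩)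
  have h1 := (mk_le_mk_of_subset hsub).trans (mk_union_le _ _)
  exact absurd (hB.trans h1) (not_le.2 (add_lt_of_lt hm (hle.trans_lt hlt) hlt))

/-- Pre-partitionability of an induced subgraph in terms of partitions of the whole vertex set. -/
theorem PrePartitionable.exists_on {V : Type u} {G : SimpleGraph V} {B : Set V}
    (h : PrePartitionable (G.induce B)) {N : Set V} (hN : N ⊆ B) (π : V → Bool) :
    ∃ π' : V → Bool, (∀ x ∉ N, π' x = π x) ∧ ∀ x ∈ N, HappyIn G B π' x := by
  classical
  obtain ⟨p, h1, h2⟩ := h {x | x.1 ∉ N} fun x => π x.1.1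
  let π' : V → Bool := fun x => if hx : x ∈ B then p ⟨x, hx⟩ else π x
  have hp : ∀ x : B, π' x = p x := fun x => by simp [π']
  refine ⟨π', fun x hx => ?_, fun x hx => ?_⟩
  · by_cases hxB : x ∈ B
    · rw [hp ⟨x, hxB⟩]; exact h1 ⟨⟨x, hxB⟩, hx⟩
    · simp [π', hxB]
  · have h3 := h2 ⟨x, hN hx⟩ (not_not.2 hx)
    have e : ∀ q : Bool → Bool → Prop,
        #{y : B // (G.induce B).Adj ⟨x, hN hx⟩ y ∧ q (p y) (p ⟨x, hN hx⟩)} =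
        #{y | y ∈ B ∧ G.Adj x y ∧ q (π' y) (π' x)} := by
      intro q
      refine mk_congr ⟨fun y => ⟨y.1.1, y.1.2, y.2.1, ?_⟩, fun y => ⟨⟨y.1, y.2.1⟩, y.2.2.1, ?_⟩,
        fun y => rfl, fun y => rfl⟩
      · rw [hp y.1, hp ⟨x, hN hx⟩]; exact y.2.2
      · rw [← hp ⟨y.1, y.2.1⟩, ← hp ⟨x, hN hx⟩]; exact y.2.2.2
    unfold HappyIn
    unfold Happy at h3
    rw [e (fun a b => a = b), e (fun a b => a ≠ b)] at h3
    exact h3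

section Glued

variable {V I : Type u} {G : SimpleGraph V} {S : Set V} {c : V → I} {U : Set V} {π : V → Bool}

theorem piece_subset_pieces {X : Set I} {i : I} (hi : i ∈ X) : piece S c i ⊆ pieces S c X :=
  fun _ hx => Or.inr ⟨hx.1, hx.2 ▸ hi⟩

theorem pieces_eq (X : Set I) : pieces S c X = S ∪ ⋃ i ∈ X, piece S c i := by
  ext x
  simp only [pieces, piece, Set.mem_union, Set.mem_ofPred_eq, Set.mem_iUnion, exists_prop]
  grind

theorem IsGlued.neighborSet_subset (hG : IsGlued G S c) {X : Set I} {i : I} (hi : i ∈ X) {x : V}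
    (hx : x ∈ piece S c i) : G.neighborSet x ⊆ pieces S c X := by
  intro y hy
  by_cases hyS : y ∈ S
  · exact Or.inl hyS
  · exact Or.inr ⟨hyS, by rw [← hG.eq_of_adj x y hx.1 hyS hy, hx.2]; exact hi⟩

/-- A set with infinitely many, at least `κ`, vertices in `S` and finitely many pieces has at least
`κ` vertices in one of these pieces. -/
theorem IsGlued.exists_large_piece (hG : IsGlued G S c) {X : Set I} (hX : X.Finite) {O : Set V}
    {κ : Cardinal.{u}} (hκ : ℵ₀ ≤ κ) (h : κ ≤ #↥(O ∩ pieces S c X)) :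
    ∃ i ∈ X, κ ≤ #↥(O ∩ piece S c i) := by
  by_contra! hcon
  have hsub : O ∩ pieces S c X ⊆ S ∪ ⋃ i ∈ X, O ∩ piece S c i := by
    rw [pieces_eq]
    rintro x ⟨hx, hxS | hxX⟩
    · exact Or.inl hxS
    · obtain ⟨i, hi, hxi⟩ := Set.mem_iUnion₂.1 hxX
      exact Or.inr (Set.mem_biUnion hi ⟨hx, hxi⟩)
  have h1 := (mk_le_mk_of_subset hsub).trans (mk_union_le _ _)
  exact absurd (h.trans h1) (not_le.2 (add_lt_of_lt hκ
    ((lt_aleph0_iff_set_finite.2 hG.finite).trans_le hκ) (mk_biUnion_lt_of_finite hX _ hκ hcon)))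

/-- A set of at least `κ` vertices with at most `l < κ` of them in each piece meets at least `κ`
pieces. -/
theorem IsGlued.le_mk_pieces (hG : IsGlued G S c) {O : Set V} {κ l : Cardinal.{u}} (hκ : ℵ₀ ≤ κ)
    (hl : l < κ) (hO : κ ≤ #O) (h : ∀ i, #↥(O ∩ piece S c i) ≤ l) :
    κ ≤ #{i | (O ∩ piece S c i).Nonempty} := by
  by_contra! hcon
  set J : Set I := {i | (O ∩ piece S c i).Nonempty}
  have hsub : O ⊆ S ∪ ⋃ i ∈ J, O ∩ piece S c i := by
    intro x hx
    by_cases hxS : x ∈ S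
    · exact Or.inl hxS
    · exact Or.inr (Set.mem_biUnion (x := c x) ⟨x, hx, hxS, rfl⟩ ⟨hx, hxS, rfl⟩)
  have hsup : ⨆ i : J, #↥(O ∩ piece S c i) < κ := (ciSup_le' fun i : J => h i).trans_lt hl
  have h1 := (mk_le_mk_of_subset hsub).trans (mk_union_le _ _)
  refine absurd (hO.trans h1) (not_le.2 (add_lt_of_lt hκ
    ((lt_aleph0_iff_set_finite.2 hG.finite).trans_le hκ) ?_))
  exact (mk_biUnion_le _ _).trans_lt (mul_lt_of_lt hκ hcon hsup)

/-- The partition `ρ` is admissible for the piece `i`, relative to a partition `σ` of `S` and to a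
partition `π` prescribed on `U`: it extends `σ`, respects
the prescription in the piece, and makes the other vertices of the piece happy. -/
structure Adm (G : SimpleGraph V) (S : Set V) (c : V → I) (U : Set V) (π : V → Bool)
    (σ : S → Bool) (i : I) (ρ : V → Bool) : Prop where
  bdry : ∀ x : S, ρ x = σ x
  ext : ∀ x ∈ piece S c i, x ∈ U → ρ x = π x
  happy : ∀ x ∈ piece S c i, x ∉ U → Happy G ρ x

theorem IsGlued.exists_adm (hG : IsGlued G S c) (U : Set V) (π : V → Bool) (σ : S → Bool) (i : I) :
    ∃ ρ, Adm G S c U π σ i ρ := by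
  classical
  have hi : i ∈ ({i} : Set I) := rfl
  obtain ⟨ρ, h1, h2⟩ := (hG.pre {i} (Set.finite_singleton i)).exists_on
    (N := piece S c i \ U) (Set.sdiff_subset.trans (piece_subset_pieces hi))
    (fun x => if hx : x ∈ S then σ ⟨x, hx⟩ else π x)
  refine ⟨ρ, fun x => ?_, fun x hx hxU => ?_, fun x hx hxU => ?_⟩
  · rw [h1 x fun h => h.1.1 x.2]; simp
  · rw [h1 x fun h => h.2 hxU]; simp [hx.1]
  · exact (h2 x ⟨hx, hxU⟩).happy (hG.neighborSet_subset hi hx)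

/-- Admissible partitions of the pieces, with the same partition of `S`, fit together. -/
theorem IsGlued.exists_glue (hG : IsGlued G S c) {σ : S → Bool} {ρ : I → V → Bool}
    (hρ : ∀ i, Adm G S c U π σ i (ρ i)) :
    ∃ π' : V → Bool, (∀ x : S, π' x = σ x) ∧ (∀ i, ∀ x ∈ piece S c i, π' x = ρ i x) ∧
      (∀ i, Adm G S c U π σ i π') ∧
      ∀ i, ∀ s ∈ S, oppSet G π' s ∩ piece S c i = oppSet G (ρ i) s ∩ piece S c i := by
  classical
  let π' : V → Bool := fun x => if hx : x ∈ S then σ ⟨x, hx⟩ else ρ (c x) x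
  have h1 : ∀ x : S, π' x = σ x := fun x => by simp [π']
  have h2 : ∀ i, ∀ x ∈ piece S c i, π' x = ρ i x := by
    rintro _ x ⟨hx, rfl⟩; simp [π', hx]
  refine ⟨π', h1, h2, fun i => ⟨h1, fun x hx hxU => ?_, fun x hx hxU => ?_⟩, fun i s hs => ?_⟩
  · rw [h2 i x hx, (hρ i).ext x hx hxU]
  · refine ((hρ i).happy x hx hxU).congr (h2 i x hx) fun y hy => ?_
    by_cases hyS : y ∈ S
    · rw [h1 ⟨y, hyS⟩, ← (hρ i).bdry ⟨y, hyS⟩]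
    · exact h2 i y ⟨hyS, by rw [← hG.eq_of_adj x y hx.1 hyS hy, hx.2]⟩
  · have hs' : π' s = ρ i s := (h1 ⟨s, hs⟩).trans ((hρ i).bdry ⟨s, hs⟩).symm
    ext y
    refine and_congr_left fun hy => ?_
    change G.Adj s y ∧ π' y ≠ π' s ↔ G.Adj s y ∧ ρ i y ≠ ρ i s
    rw [hs', h2 i y hy]

/-- If a partition of `S` is changed only at vertices with at most `lam` neighbours in the piece
`i`, then an admissible partition of this piece can be adapted by recolouring at most `lam` of its
vertices. -/
theorem Adm.exists_adm_change (hG : IsGlued G S c) {σ σ' : S → Bool} {i : I} {ρ : V → Bool}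
    (hρ : Adm G S c U π σ i ρ) {lam : Cardinal.{u}} (hl : ℵ₀ ≤ lam)
    (hσ : ∀ s : S, σ' s ≠ σ s → #↥(G.neighborSet s ∩ piece S c i) ≤ lam) :
    ∃ ρ', Adm G S c U π σ' i ρ' ∧ #{x | x ∈ piece S c i ∧ ρ' x ≠ ρ x} ≤ lam := by
  classical
  have hi : i ∈ ({i} : Set I) := rfl
  have := hG.finite.to_subtype
  let ρ₀ : V → Bool := fun x => if hx : x ∈ S then σ' ⟨x, hx⟩ else ρ x
  have hS : ∀ x : S, ρ₀ x = σ' x := fun x => by simp [ρ₀]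
  have hnS : ∀ x, x ∉ S → ρ₀ x = ρ x := fun x hx => by simp [ρ₀, hx]
  let A : Set V := ⋃ s ∈ {s : S | σ' s ≠ σ s}, G.neighborSet s ∩ piece S c i
  have hA : #A ≤ lam := by
    refine Order.lt_succ_iff.1 (mk_biUnion_lt_of_finite (Set.toFinite _) _
      (hl.trans (Order.le_succ _)) fun s hs => Order.lt_succ_iff.2 (hσ s hs))
  have hM : ∀ x ∈ piece S c i \ U, Happy G ρ₀ x ∨ (x ∈ A ∧ #(G.neighborSet x) ≤ lam) := by
    intro x hx
    have hh := hρ.happy x hx.1 hx.2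
    by_cases hd : #(G.neighborSet x) ≤ lam
    · by_cases hxA : x ∈ A
      · exact Or.inr ⟨hxA, hd⟩
      · refine Or.inl (hh.congr (hnS x hx.1.1) fun y hy => ?_)
        by_cases hyS : y ∈ S
        · by_contra hne
          refine hxA (Set.mem_biUnion (x := (⟨y, hyS⟩ : S)) (fun e => hne ?_) ⟨hy.symm, hx.1⟩)
          rw [hS ⟨y, hyS⟩, hρ.bdry ⟨y, hyS⟩, e]
        · exact hnS y hyS
    · refine Or.inl (hh.recolor hl (not_le.1 hd) (hnS x hx.1.1) ?_)
      refine (mk_le_mk_of_subset (t := S) fun y hy => ?_).trans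
        ((lt_aleph0_iff_set_finite.2 hG.finite).le.trans hl)
      by_contra hyS
      exact hy.2 (hnS y hyS)
  obtain ⟨ρ', h1, h2, h3⟩ := exists_recolor hl hA ρ₀ hM fun N hN _ => by
    obtain ⟨ρ', h1, h2⟩ := (hG.pre {i} (Set.finite_singleton i)).exists_on
      (hN.trans (Set.sdiff_subset.trans (piece_subset_pieces hi))) ρ₀
    exact ⟨ρ', h1, fun x hx => (h2 x hx).happy (hG.neighborSet_subset hi (hN hx).1)⟩
  refine ⟨ρ', ⟨fun x => ?_, fun x hx hxU => ?_, fun x hx hxU => h3 x ⟨hx, hxU⟩⟩, ?_⟩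
  · rw [h1 x fun h => h.1.1 x.2, hS]
  · rw [h1 x fun h => h.2 hxU, hnS x hx.1, hρ.ext x hx hxU]
  · refine (mk_le_mk_of_subset fun x hx => ?_).trans h2
    change ρ' x ≠ ρ₀ x
    rw [hnS x hx.1.1]
    exact hx.2

/-! ### Supplying the vertices of the finite set with opponents -/

/-- The set of those pieces in which some admissible partition gives `s` more than `l` opponents. -/
def Ach (G : SimpleGraph V) (S : Set V) (c : V → I) (U : Set V) (π : V → Bool)
    (σ : S → Bool) (s : V) (l : Cardinal.{u}) : Set I :=
  {i | ∃ ρ, Adm G S c U π σ i ρ ∧ l < #↥(oppSet G ρ s ∩ piece S c i)}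

theorem Ach.anti {σ : S → Bool} {s : V} {l l' : Cardinal.{u}} (h : l ≤ l') :
    Ach G S c U π σ s l' ⊆ Ach G S c U π σ s l :=
  fun _ ⟨ρ, h1, h2⟩ => ⟨ρ, h1, h.trans_lt h2⟩

/-- The partition `σ` of `S` leaves every vertex of `T` a way to obtain `κ` opponents: either in one
of the pieces in `X`, for which the admissible partition `ρ i` has been selected, or by one opponent
in each of `κ` pieces, or by arbitrarily large numbers below `κ` in suitable pieces. -/
structure Good (G : SimpleGraph V) (S : Set V) (c : V → I) (U : Set V) (π : V → Bool) (T : Set V)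
    (κ : Cardinal.{u}) (σ : S → Bool) (X : Set I) (ρ : I → V → Bool) : Prop where
  adm : ∀ i ∈ X, Adm G S c U π σ i (ρ i)
  opp : ∀ s ∈ T, (∃ i ∈ X, κ ≤ #↥(oppSet G (ρ i) s ∩ piece S c i)) ∨
    κ ≤ #(Ach G S c U π σ s 0) ∨
    ((∀ i, #↥(G.neighborSet s ∩ piece S c i) < κ) ∧ ∀ l < κ, (Ach G S c U π σ s l).Nonempty)

/-- The possibilities to obtain `κ` opponents outside finitely many pieces, brought into a common
form: a family of demands for opponents, such that each can be met in at least as many pieces as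
there are demands, and such that meeting all of them in different pieces yields `κ` opponents. -/
theorem exists_demands {σ : S → Bool} {s : V} {κ : Cardinal.{u}} (hκ : ℵ₀ ≤ κ)
    (h : κ ≤ #(Ach G S c U π σ s 0) ∨
      ((∀ i, #↥(G.neighborSet s ∩ piece S c i) < κ) ∧ ∀ l < κ, (Ach G S c U π σ s l).Nonempty)) :
    ∃ (R : Type u) (d : R → Cardinal.{u}), ℵ₀ ≤ #R ∧ (∀ r, #R ≤ #(Ach G S c U π σ s (d r))) ∧
      (κ ≤ #R ∨ ∀ l < κ, ∃ r, l ≤ d r) := by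
  rcases h with h | ⟨h1, h2⟩
  · exact ⟨Ach G S c U π σ s 0, fun _ => 0, hκ.trans h, fun _ => le_rfl, Or.inl h⟩
  · -- `Ach l` decreases with `l`; let `l₀` be such that its cardinality is minimal
    obtain ⟨m, ⟨l₀, hl₀, rfl⟩, hmin⟩ := WellFounded.has_min (wellFounded_lt (α := Cardinal.{u}))
      ((fun l => #(Ach G S c U π σ s l)) '' Set.Iio κ) ⟨_, 0, aleph0_pos.trans_le hκ, rfl⟩
    have hmin' : ∀ l < κ, #(Ach G S c U π σ s l₀) ≤ #(Ach G S c U π σ s l) := fun l hl =>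
      not_lt.1 (hmin _ ⟨l, hl, rfl⟩)
    have hdeg : ∀ i l, i ∈ Ach G S c U π σ s l → l < #↥(G.neighborSet s ∩ piece S c i) := by
      rintro i l ⟨ρ, _, h⟩
      exact h.trans_le (mk_le_mk_of_subset (Set.inter_subset_inter_left _ (oppSet_subset G ρ s)))
    refine ⟨Ach G S c U π σ s l₀, fun i => #↥(G.neighborSet s ∩ piece S c i), ?_,
      fun i => hmin' _ (h1 i), Or.inr fun l hl => ?_⟩
    · by_contra! hlt
      obtain ⟨i, hi, hmax⟩ := Set.exists_max_image (Ach G S c U π σ s l₀)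
        (fun i => #↥(G.neighborSet s ∩ piece S c i)) (lt_aleph0_iff_set_finite.1 hlt) (h2 l₀ hl₀)
      obtain ⟨j, hj⟩ := h2 (max l₀ #↥(G.neighborSet s ∩ piece S c i)) (max_lt hl₀ (h1 i))
      exact absurd (hdeg j _ (Ach.anti (le_max_right _ _) hj))
        (not_lt.2 (hmax j (Ach.anti (le_max_left _ _) hj)))
    · obtain ⟨j, hj⟩ := h2 (max l₀ l) (max_lt hl₀ hl)
      exact ⟨⟨j, Ach.anti (le_max_left _ _) hj⟩, (hdeg j _ (Ach.anti (le_max_right _ _) hj)).le⟩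

/-- If the partition `σ` of `S` is good for `T`, then it extends to a partition in which all
vertices outside `S` are happy and all vertices of `T` have `κ` opponents: different demands are
assigned to different pieces. -/
theorem Good.exists_partition (hG : IsGlued G S c) {T : Set V} (hT : T ⊆ S) {κ : Cardinal.{u}}
    (hκ : ℵ₀ ≤ κ) {σ : S → Bool} {X : Set I} (hX : X.Finite) {ρ : I → V → Bool}
    (h : Good G S c U π T κ σ X ρ) :
    ∃ π' : V → Bool, (∀ x : S, π' x = σ x) ∧ (∀ i, Adm G S c U π σ i π') ∧
      (∀ s ∈ T, κ ≤ #(oppSet G π' s)) ∧ ∀ i ∈ X, ∀ x ∈ piece S c i, π' x = ρ i x := by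
  classical
  let T' := {s : V // s ∈ T ∧ ¬ ∃ i ∈ X, κ ≤ #↥(oppSet G (ρ i) s ∩ piece S c i)}
  have : Finite T' := (hG.finite.subset fun s hs => hT hs.1).to_subtype
  choose R d hR hd hsum using fun t : T' =>
    exists_demands hκ ((h.opp t.1 t.2.1).resolve_left t.2.2)
  obtain ⟨f, hf, hinj⟩ := exists_transversal_sigma R
    (fun t r => Ach G S c U π σ t.1 (d t r) \ X) hR (fun t r => by
      by_contra! hlt
      have h1 : #(Ach G S c U π σ t.1 (d t r)) ≤ #↥(Ach G S c U π σ t.1 (d t r) \ X) + #X :=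
        (mk_le_mk_of_subset (by rw [Set.sdiff_union_self]; exact Set.subset_union_left)).trans
          (mk_union_le _ _)
      exact absurd ((hd t r).trans h1) (not_le.2 (add_lt_of_lt (hR t) hlt
        ((lt_aleph0_iff_set_finite.2 hX).trans_le (hR t)))))
  have hchoice : ∀ i, ∃ ρ', Adm G S c U π σ i ρ' ∧ (i ∈ X → ρ' = ρ i) ∧
      ∀ j : Σ t, R t, f j = i → d j.1 j.2 < #↥(oppSet G ρ' j.1.1 ∩ piece S c i) := by
    intro i
    by_cases hi : i ∈ X
    · exact ⟨ρ i, h.adm i hi, fun _ => rfl, fun j hj => absurd (hj ▸ hi) (hf j).2⟩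
    · by_cases hj : ∃ j, f j = i
      · obtain ⟨j, rfl⟩ := hj
        obtain ⟨ρ', h1, h2⟩ := (hf j).1
        refine ⟨ρ', h1, fun h => absurd h hi, fun j' hj' => ?_⟩
        obtain rfl := hinj hj'
        exact h2
      · obtain ⟨ρ', h1⟩ := hG.exists_adm U π σ i
        exact ⟨ρ', h1, fun h => absurd h hi, fun j hj' => absurd ⟨j, hj'⟩ hj⟩
  choose ρ' h1 h2 h3 using hchoice
  obtain ⟨π', e1, e2, e3, e4⟩ := hG.exists_glue h1
  refine ⟨π', e1, e3, fun s hs => ?_, fun i hi x hx => by rw [e2 i x hx, h2 i hi]⟩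
  by_cases hsX : ∃ i ∈ X, κ ≤ #↥(oppSet G (ρ i) s ∩ piece S c i)
  · obtain ⟨i, hi, hle⟩ := hsX
    rw [← h2 i hi, ← e4 i s (hT hs)] at hle
    exact hle.trans (mk_le_mk_of_subset Set.inter_subset_left)
  · let t : T' := ⟨s, hs, hsX⟩
    have hopp : ∀ r, d t r < #↥(oppSet G π' s ∩ piece S c (f ⟨t, r⟩)) := fun r => by
      rw [e4 _ s (hT hs)]; exact h3 _ ⟨t, r⟩ rfl
    rcases hsum t with hc | hc
    · refine hc.trans ?_
      choose g hg using fun r => Set.nonempty_coe_sort.1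
        (mk_ne_zero_iff.1 ((zero_le (a := d t r)).trans_lt (hopp r)).ne')
      refine mk_le_of_injective (f := fun r => (⟨g r, (hg r).1⟩ : oppSet G π' s)) ?_
      intro r r' hrr
      have hrr' : g r = g r' := congrArg Subtype.val hrr
      have h5 : f ⟨t, r⟩ = f ⟨t, r'⟩ := by
        rw [← (hg r).2.2, ← (hg r').2.2, hrr']
      exact eq_of_heq (Sigma.mk.inj (hinj h5)).2
    · refine le_of_forall_lt fun l hl => ?_
      obtain ⟨r, hr⟩ := hc l hl
      exact (hr.trans_lt (hopp r)).trans_le (mk_le_mk_of_subset Set.inter_subset_left)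

/-- Let every vertex of `T ⊆ S` have neighbours in at least `κ` pieces. Then finitely many pieces have
a happy partition whose restriction `σ` to `S` allows each vertex of `T` to obtain opponents in `κ`
pieces. To see this, consider all pairs of a vertex `s` and a partition `σ` for which fewer than `κ`
pieces can give `s` an opponent, and discard these pieces. From the fewer than `κ` discarded pieces
only those in `X₀` are kept. Then finitely many other pieces with sufficiently many
neighbours of each `s` are added: not all of these neighbours can be friends of `s`. -/
theorem IsGlued.exists_many_opp_pieces (hG : IsGlued G S c) (U : Set V) (π : V → Bool)
    {κ : Cardinal.{u}} (hκ : ℵ₀ ≤ κ) {T : Set V} (hT : T ⊆ S \ U) {X₀ : Set I} (hX₀ : X₀.Finite)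
    (h1 : ∀ s ∈ T, κ ≤ #{i | (G.neighborSet s ∩ piece S c i).Nonempty})
    (h2 : ∀ s ∈ T, ∀ i ∈ X₀, (G.neighborSet s ∩ piece S c i).Finite) :
    ∃ (X : Set I) (π' : V → Bool), X₀ ⊆ X ∧ X.Finite ∧ (∀ x ∈ U, π' x = π x) ∧
      (∀ x ∈ pieces S c X, x ∉ U → HappyIn G (pieces S c X) π' x) ∧
      ∀ s ∈ T, κ ≤ #(Ach G S c U π (fun x => π' x) s 0) := by
  classical
  have hTfin : T.Finite := hG.finite.subset fun s hs => (hT hs).1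
  have := hG.finite.to_subtype
  let W : Set I := ⋃ p ∈ {p : V × (S → Bool) | p.1 ∈ T ∧ #(Ach G S c U π p.2 p.1 0) < κ},
    Ach G S c U π p.2 p.1 0
  have hW : #W < κ := by
    refine mk_biUnion_lt_of_finite ?_ _ hκ fun p hp => hp.2
    exact (hTfin.prod (Set.finite_univ (α := S → Bool))).subset fun p hp => ⟨hp.1, Set.mem_univ _⟩
  let K : V → Set V := fun s => S ∪ ⋃ i ∈ X₀, G.neighborSet s ∩ piece S c i
  have hK : ∀ s ∈ T, (K s).Finite := fun s hs => hG.finite.union (hX₀.biUnion fun i hi => h2 s hs i hi)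
  have hY : ∀ s, ∃ Y : Finset I, s ∈ T → (∀ i ∈ Y, (G.neighborSet s ∩ piece S c i).Nonempty) ∧
      (∀ i ∈ Y, i ∉ W ∧ i ∉ X₀) ∧ (K s).ncard < Y.card := by
    intro s
    by_cases hs : s ∈ T
    · have hinf : ({i | (G.neighborSet s ∩ piece S c i).Nonempty} \ (W ∪ X₀)).Infinite := by
        intro hfin
        have h3 := (mk_le_mk_of_subset (s := {i | (G.neighborSet s ∩ piece S c i).Nonempty})
          (t := ({i | (G.neighborSet s ∩ piece S c i).Nonempty} \ (W ∪ X₀)) ∪ (W ∪ X₀))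
          (by rw [Set.sdiff_union_self]; exact Set.subset_union_left)).trans (mk_union_le _ _)
        refine absurd ((h1 s hs).trans h3) (not_le.2 (add_lt_of_lt hκ
          ((lt_aleph0_iff_set_finite.2 hfin).trans_le hκ)
          ((mk_union_le _ _).trans_lt (add_lt_of_lt hκ hW
            ((lt_aleph0_iff_set_finite.2 hX₀).trans_le hκ)))))
      obtain ⟨Y, hY, hc⟩ := hinf.exists_subset_card_eq ((K s).ncard + 1)
      exact ⟨Y, fun _ => ⟨fun i hi => (hY hi).1,
        fun i hi => ⟨fun h => (hY hi).2 (Or.inl h), fun h => (hY hi).2 (Or.inr h)⟩, by omega⟩⟩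
    · exact ⟨∅, fun h => absurd h hs⟩
  choose Y hY using hY
  let X : Set I := X₀ ∪ ⋃ s ∈ T, (Y s : Set I)
  have hX : X.Finite := hX₀.union (hTfin.biUnion fun s _ => (Y s).finite_toSet)
  obtain ⟨π', e1, e2⟩ := (hG.pre X hX).exists_on (N := pieces S c X \ U) Set.sdiff_subset π
  have e2' : ∀ x ∈ pieces S c X, x ∉ U → HappyIn G (pieces S c X) π' x :=
    fun x hx hxU => e2 x ⟨hx, hxU⟩
  have e1' : ∀ x ∈ U, π' x = π x := fun x hx => e1 x fun h => h.2 hx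
  refine ⟨X, π', Set.subset_union_left, hX, e1', e2', fun s hs => ?_⟩
  by_contra! hlt
  have hW' : Ach G S c U π (fun x => π' x) s 0 ⊆ W :=
    Set.subset_biUnion_of_mem (u := fun p : V × (S → Bool) => Ach G S c U π p.2 p.1 0)
      (show (s, fun x : S => π' x) ∈ {p : V × (S → Bool) | p.1 ∈ T ∧
        #(Ach G S c U π p.2 p.1 0) < κ} from ⟨hs, hlt⟩)
  have hadm : ∀ i ∈ X, Adm G S c U π (fun x => π' x) i π' := fun i hi =>
    ⟨fun _ => rfl, fun x _ hxU => e1' x hxU, fun x hx hxU =>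
      (e2' x (piece_subset_pieces hi hx) hxU).happy (hG.neighborSet_subset hi hx)⟩
  have hno : ∀ i ∈ X, i ∉ W → oppSet G π' s ∩ piece S c i = ∅ := by
    intro i hi hiW
    by_contra hne
    refine hiW (hW' ⟨π', hadm i hi, pos_iff_ne_zero.2 ?_⟩)
    have := (Set.nonempty_iff_ne_empty.2 hne).to_subtype
    exact mk_ne_zero _
  obtain ⟨hY1, hY2, hY3⟩ := hY s hs
  have hYX : ∀ i ∈ Y s, i ∈ X := fun i hi => Or.inr (Set.mem_biUnion hs hi)
  have hopp : {y | y ∈ pieces S c X ∧ G.Adj s y ∧ π' y ≠ π' s} ⊆ K s := by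
    rintro y ⟨hyX, hy⟩
    by_cases hyS : y ∈ S
    · exact Or.inl hyS
    · have hcy : c y ∈ X := (hyX.resolve_left hyS).2
      rcases hcy with h0 | h0
      · exact Or.inr (Set.mem_biUnion h0 ⟨hy.1, hyS, rfl⟩)
      · obtain ⟨t, ht, hyt⟩ := Set.mem_iUnion₂.1 h0
        have hmem : y ∈ oppSet G π' s ∩ piece S c (c y) := ⟨hy, hyS, rfl⟩
        rw [hno _ (Or.inr h0) (((hY t ht).2.1 _ hyt).1)] at hmem
        exact absurd hmem (Set.notMem_empty y)
  have hfr : #(Y s) ≤ #{y | y ∈ pieces S c X ∧ G.Adj s y ∧ π' y = π' s} := by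
    choose g hg using fun i : Y s => hY1 i i.2
    refine mk_le_of_injective (f := fun i => ⟨g i, piece_subset_pieces (hYX i i.2) (hg i).2,
      (hg i).1, ?_⟩) ?_
    · by_contra hne
      have hmem : g i ∈ oppSet G π' s ∩ piece S c i := ⟨⟨(hg i).1, hne⟩, (hg i).2⟩
      rw [hno _ (hYX i i.2) ((hY2 i i.2).1)] at hmem
      exact Set.notMem_empty _ hmem
    · intro i j hij
      have hij' : g i = g j := congrArg Subtype.val hij
      exact Subtype.ext (by rw [← (hg i).2.2, ← (hg j).2.2, hij'])
  have hs' := hT hs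
  have h3 := hfr.trans ((e2' s (Or.inl hs'.1) hs'.2).trans (mk_le_mk_of_subset hopp))
  rw [← Set.cast_ncard (hK s hs)] at h3
  simp only [mk_coe_finset, Nat.cast_le] at h3
  omega

/-! ### Gluing preserves pre-partitionability -/

/-- The partition `π` prescribed on `U` extends to one in which all vertices outside `U` are happy. -/
def Extends (G : SimpleGraph V) (U : Set V) (π : V → Bool) : Prop :=
  ∃ π' : V → Bool, (∀ x ∈ U, π' x = π x) ∧ ∀ x ∉ U, Happy G π' x

/-- If only vertices of `S` of degree at most `lam` are unhappy, while some vertex of `S` that may be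
recoloured has larger degree, then the recolouring principle leads to extension problems in which
this vertex is prescribed too, and the induction hypothesis applies. -/
theorem Extends.of_small_degree (hS : S.Finite)
    (ih : ∀ (U' : Set V) (π' : V → Bool), (S \ U').ncard < (S \ U).ncard → Extends G U' π')
    {lam : Cardinal.{u}} (hl : ℵ₀ ≤ lam) {s : V} (hs : s ∈ S \ U)
    (hsd : lam < #(G.neighborSet s)) (h : ∃ π' : V → Bool, (∀ x ∈ U, π' x = π x) ∧
      ∀ x ∉ U, Happy G π' x ∨ (x ∈ S ∧ #(G.neighborSet x) ≤ lam)) : Extends G U π := by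
  obtain ⟨π', h1, h2⟩ := h
  obtain ⟨π'', h3, _, h5⟩ := exists_recolor (M := Uᶜ) (A := S) hl
    ((lt_aleph0_iff_set_finite.2 hS).le.trans hl) π' h2 fun N hN hNd => by
      obtain ⟨π'', h3, h4⟩ := ih Nᶜ π' (Set.ncard_lt_ncard ⟨fun x hx =>
        ⟨hx.1, hN (not_not.1 hx.2)⟩, fun hsub => (hsub hs).2 fun hsN =>
          absurd (hNd s hsN) (not_le.2 hsd)⟩ (hS.subset Set.sdiff_subset))
      exact ⟨π'', fun x hx => h3 x hx, fun x hx => h4 x (not_not.2 hx)⟩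
  exact ⟨π'', fun x hx => (h3 x (not_not.2 hx)).trans (h1 x hx), fun x hx => h5 x hx⟩

theorem adm_of_happyIn (hG : IsGlued G S c) {X : Set I} {π' : V → Bool}
    (h1 : ∀ x ∈ U, π' x = π x)
    (h2 : ∀ x ∈ pieces S c X, x ∉ U → HappyIn G (pieces S c X) π' x) {i : I} (hi : i ∈ X) :
    Adm G S c U π (fun x => π' x) i π' :=
  ⟨fun _ => rfl, fun x _ hxU => h1 x hxU, fun x hx hxU =>
    (h2 x (piece_subset_pieces hi hx) hxU).happy (hG.neighborSet_subset hi hx)⟩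

/-- A partition which is admissible for all pieces and respects the prescription on `S` extends it,
and only vertices of `S` can be unhappy. -/
theorem extends_aux {σ : S → Bool} (hσ : ∀ x : S, x.1 ∈ U → σ x = π x) {π' : V → Bool}
    (h : ∀ i, Adm G S c U π σ i π') : (∀ x ∈ U, π' x = π x) ∧
      ∀ x ∉ U, x ∉ S → Happy G π' x := by
  refine ⟨fun x hx => ?_, fun x hx hxS => (h (c x)).happy x ⟨hxS, rfl⟩ hx⟩
  by_cases hxS : x ∈ S
  · rw [(h (c x)).bdry ⟨x, hxS⟩, hσ ⟨x, hxS⟩ hx]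
  · exact (h (c x)).ext x ⟨hxS, rfl⟩ hx

/-- The case that every vertex of `S` that may be recoloured has countable degree. The vertices of
`S` that have finite degree or infinitely many neighbours in one piece are made happy already by a
partition of finitely many pieces, and the others obtain opponents in infinitely many pieces. -/
theorem IsGlued.extends_of_countable (hG : IsGlued G S c) (U : Set V) (π : V → Bool)
    (hd : ∀ s ∈ S \ U, #(G.neighborSet s) ≤ ℵ₀) : Extends G U π := by
  classical
  -- the pieces that meet the neighbourhood of `s` if it is finite, and a piece that contains
  -- infinitely many neighbours of `s` if there is one
  have hX₀ : ∀ s, ∃ Y : Set I, Y.Finite ∧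
      ((G.neighborSet s).Finite → c '' G.neighborSet s ⊆ Y) ∧
      ((∃ i, (G.neighborSet s ∩ piece S c i).Infinite) →
        ∃ i ∈ Y, (G.neighborSet s ∩ piece S c i).Infinite) := by
    intro s
    by_cases hf : (G.neighborSet s).Finite
    · exact ⟨_, hf.image c, fun _ => le_rfl,
        fun ⟨i, hi⟩ => absurd (hf.subset Set.inter_subset_left) hi⟩
    · by_cases hi : ∃ i, (G.neighborSet s ∩ piece S c i).Infinite
      · obtain ⟨i, hi⟩ := hi
        exact ⟨{i}, Set.finite_singleton i, fun h => absurd h hf, fun _ => ⟨i, rfl, hi⟩⟩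
      · exact ⟨∅, Set.finite_empty, fun h => absurd h hf, fun h => absurd h hi⟩
  choose Y hYf hY1 hY2 using hX₀
  let T : Set V := {s ∈ S \ U | (G.neighborSet s).Infinite ∧
    ∀ i, (G.neighborSet s ∩ piece S c i).Finite}
  obtain ⟨X, π', hX₀X, hX, h1, h2, h3⟩ := hG.exists_many_opp_pieces U π (κ := ℵ₀) le_rfl (T := T)
    (fun s hs => hs.1) (X₀ := ⋃ s ∈ S, Y s) (hG.finite.biUnion fun s _ => hYf s)
    (fun s hs => by
      refine aleph0_le_mk_iff.2 (Set.infinite_coe_iff.2 fun hfin => hs.2.1 ?_)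
      refine (hG.finite.union (hfin.biUnion fun i _ => hs.2.2 i)).subset fun y hy => ?_
      by_cases hyS : y ∈ S
      · exact Or.inl hyS
      · exact Or.inr (Set.mem_biUnion (x := c y) ⟨y, hy, hyS, rfl⟩ ⟨hy, hyS, rfl⟩))
    (fun s hs i _ => hs.2.2 i)
  have hYX : ∀ s ∈ S, Y s ⊆ X := fun s hs => (Set.subset_biUnion_of_mem hs).trans hX₀X
  have hgood : Good G S c U π {s ∈ S \ U | (G.neighborSet s).Infinite} ℵ₀ (fun x => π' x) X
      fun _ => π' := by
    refine ⟨fun i hi => adm_of_happyIn hG h1 h2 hi, fun s hs => ?_⟩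
    by_cases hi : ∃ i, (G.neighborSet s ∩ piece S c i).Infinite
    · obtain ⟨i, hi, hinf⟩ := hY2 s hi
      refine Or.inl (hG.exists_large_piece hX le_rfl ?_)
      refine (h2 s (Or.inl hs.1.1) hs.1.2).le_opp le_rfl ?_
      refine (aleph0_le_mk_iff.2 (Set.infinite_coe_iff.2 hinf)).trans (mk_le_mk_of_subset ?_)
      exact Set.inter_subset_inter_right _ (piece_subset_pieces (hYX s hs.1.1 hi))
    · push Not at hi
      exact Or.inr (Or.inl (h3 s ⟨hs.1, hs.2, fun i => hi i⟩))
  obtain ⟨π'', e1, e2, e3, e4⟩ := hgood.exists_partition hG (fun s hs => hs.1.1) le_rfl hX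
  obtain ⟨e5, e6⟩ := extends_aux (fun x hx => h1 x hx) e2
  refine ⟨π'', e5, fun x hx => ?_⟩
  by_cases hxS : x ∈ S
  · by_cases hf : (G.neighborSet x).Finite
    · have hsub : G.neighborSet x ⊆ pieces S c X := fun y hy => by
        by_cases hyS : y ∈ S
        · exact Or.inl hyS
        · exact Or.inr ⟨hyS, hYX x hxS (hY1 x hf ⟨y, hy, rfl⟩)⟩
      refine ((h2 x (Or.inl hxS) hx).happy hsub).congr (e1 ⟨x, hxS⟩) fun y hy => ?_
      by_cases hyS : y ∈ S
      · exact e1 ⟨y, hyS⟩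
      · exact e4 (c y) ((hsub hy).resolve_left hyS).2 y ⟨hyS, rfl⟩
    · exact happy_of_le ((hd x ⟨hxS, hx⟩).trans (e3 x ⟨⟨hxS, hx⟩, hf⟩))
  · exact e6 x hx hxS

/-- The case that the largest degree `κ` of a vertex of `S` that may be recoloured is uncountable.
Only the vertices of degree `κ` have to be made happy. If their degrees into the pieces are bounded
below `κ`, this is `IsGlued.exists_many_opp_pieces`. Otherwise, a partition of finitely many pieces
fixes the colours of those vertices whose degrees into the pieces are unbounded; the induction
hypothesis then determines the colours of the other vertices of `S`. These have so few neighbours in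
each piece that the former vertices can still be given opponents, and they have obtained opponents
in `κ` pieces themselves. -/
theorem IsGlued.extends_of_uncountable (hG : IsGlued G S c) (U : Set V) (π : V → Bool)
    (ih : ∀ (U' : Set V) (π' : V → Bool), (S \ U').ncard < (S \ U).ncard → Extends G U' π')
    {κ : Cardinal.{u}} (hκ : ℵ₀ < κ) (hd : ∀ s ∈ S \ U, #(G.neighborSet s) ≤ κ)
    {s₀ : V} (hs₀ : s₀ ∈ S \ U) (hs₀d : #(G.neighborSet s₀) = κ) : Extends G U π := by
  classical
  have hSf := hG.finite.to_subtype
  let T : Set V := {s ∈ S \ U | #(G.neighborSet s) = κ}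
  -- `Tu` consists of those vertices of `T` whose degrees into the pieces have no bound below `κ`
  let Tu : Set V := {s ∈ T | ∀ l < κ, ∃ i, l < #↥(G.neighborSet s ∩ piece S c i)}
  have hTS : T ⊆ S := fun s hs => hs.1.1
  obtain ⟨lam, hl, hlκ, hlam⟩ := exists_uniform_bound (hG.finite.subset Set.sdiff_subset) hκ
    (S := S \ U) (fun s l => (s ∉ T → #(G.neighborSet s) ≤ l) ∧
      (s ∉ Tu → ∀ i, #↥(G.neighborSet s ∩ piece S c i) ≤ l)) (by
    intro s hs
    by_cases hsT : s ∈ T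
    · by_cases hsu : s ∈ Tu
      · exact ⟨0, aleph0_pos.trans hκ, fun h => absurd hsT h, fun h => absurd hsu h⟩
      · have : ∃ l < κ, ∀ i, #↥(G.neighborSet s ∩ piece S c i) ≤ l := by
          by_contra! hcon
          exact hsu ⟨hsT, hcon⟩
        obtain ⟨l, h1, h2⟩ := this
        exact ⟨l, h1, fun h => absurd hsT h, fun _ => h2⟩
    · exact ⟨_, lt_of_le_of_ne (hd s hs) fun h => hsT ⟨hs, h⟩, fun _ => le_rfl,
        fun _ i => mk_le_mk_of_subset Set.inter_subset_left⟩)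
    (fun s l l' hll h => ⟨fun hs => (h.1 hs).trans hll, fun hs i => (h.2 hs i).trans hll⟩)
  -- it suffices to make the vertices of `T` happy, since the others have smaller degree
  have hfinish : ∀ (σ : S → Bool) (X : Set I) (ρ : I → V → Bool), X.Finite →
      (∀ x : S, x.1 ∈ U → σ x = π x) → Good G S c U π T κ σ X ρ → Extends G U π := by
    intro σ X ρ hX hσ hgood
    obtain ⟨π', _, e2, e3, _⟩ := hgood.exists_partition hG hTS hκ.le hX
    obtain ⟨e5, e6⟩ := extends_aux hσ e2
    refine Extends.of_small_degree hG.finite ih hl hs₀ (hs₀d ▸ hlκ) ⟨π', e5, fun x hx => ?_⟩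
    by_cases hxS : x ∈ S
    · by_cases hxT : x ∈ T
      · exact Or.inl (happy_of_le (hxT.2.le.trans (e3 x hxT)))
      · exact Or.inr ⟨hxS, (hlam x ⟨hxS, hx⟩).1 hxT⟩
    · exact Or.inl (e6 x hx hxS)
  rcases Tu.eq_empty_or_nonempty with hTu | ⟨s₁, hs₁⟩
  · have hb : ∀ s ∈ T, ∀ i, #↥(G.neighborSet s ∩ piece S c i) ≤ lam := fun s hs =>
      (hlam s hs.1).2 (hTu ▸ Set.notMem_empty s)
    obtain ⟨X, π', _, hX, h1, h2, h3⟩ := hG.exists_many_opp_pieces U π hκ.le (T := T)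
      (fun s hs => hs.1) (X₀ := ∅) Set.finite_empty
      (fun s hs => hG.le_mk_pieces hκ.le hlκ hs.2.ge (hb s hs))
      (fun s _ i hi => absurd hi (Set.notMem_empty i))
    exact hfinish _ X (fun _ => π') hX (fun x hx => h1 x hx)
      ⟨fun i hi => adm_of_happyIn hG h1 h2 hi, fun s hs => Or.inr (Or.inl (h3 s hs))⟩
  · -- finitely many pieces that rule out all partitions of `S` that are not good for `Tu`: if `s`
    -- can obtain at most `l` opponents in each piece, then add a piece with more than `l` neighbours
    have hY : ∀ p : V × (S → Bool), ∃ Y : Set I, Y.Finite ∧ (p.1 ∈ Tu →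
        ((∃ i, κ ≤ #↥(G.neighborSet p.1 ∩ piece S c i)) →
          ∃ i ∈ Y, κ ≤ #↥(G.neighborSet p.1 ∩ piece S c i)) ∧
        ((∃ l < κ, Ach G S c U π p.2 p.1 l = ∅) → ∃ l, ℵ₀ ≤ l ∧ Ach G S c U π p.2 p.1 l = ∅ ∧
          ∃ i ∈ Y, l < #↥(G.neighborSet p.1 ∩ piece S c i))) := by
      rintro ⟨s, σ⟩
      have hA : ∃ Y : Set I, Y.Finite ∧ ((∃ i, κ ≤ #↥(G.neighborSet s ∩ piece S c i)) →
          ∃ i ∈ Y, κ ≤ #↥(G.neighborSet s ∩ piece S c i)) := by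
        by_cases h : ∃ i, κ ≤ #↥(G.neighborSet s ∩ piece S c i)
        · obtain ⟨i, hi⟩ := h
          exact ⟨{i}, Set.finite_singleton i, fun _ => ⟨i, rfl, hi⟩⟩
        · exact ⟨∅, Set.finite_empty, fun h' => absurd h' h⟩
      have hB : ∃ Y : Set I, Y.Finite ∧ (s ∈ Tu → (∃ l < κ, Ach G S c U π σ s l = ∅) →
          ∃ l, ℵ₀ ≤ l ∧ Ach G S c U π σ s l = ∅ ∧
            ∃ i ∈ Y, l < #↥(G.neighborSet s ∩ piece S c i)) := by
        by_cases h : s ∈ Tu ∧ ∃ l < κ, Ach G S c U π σ s l = ∅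
        · obtain ⟨hs, l, hlt, he⟩ := h
          obtain ⟨i, hi⟩ := hs.2 (max ℵ₀ l) (max_lt hκ hlt)
          exact ⟨{i}, Set.finite_singleton i, fun _ _ => ⟨max ℵ₀ l, le_max_left _ _,
            Set.subset_empty_iff.1 (he ▸ Ach.anti (le_max_right _ _)), i, rfl, hi⟩⟩
        · exact ⟨∅, Set.finite_empty, fun hs h' => absurd ⟨hs, h'⟩ h⟩
      obtain ⟨Y₁, hf₁, h₁⟩ := hA
      obtain ⟨Y₂, hf₂, h₂⟩ := hB
      refine ⟨Y₁ ∪ Y₂, hf₁.union hf₂, fun hs => ⟨fun h => ?_, fun h => ?_⟩⟩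
      · obtain ⟨i, hi, h⟩ := h₁ h
        exact ⟨i, Or.inl hi, h⟩
      · obtain ⟨l, hl, he, i, hi, h⟩ := h₂ hs h
        exact ⟨l, hl, he, i, Or.inr hi, h⟩
    choose Y hYf hY using hY
    let X : Set I := ⋃ p ∈ S ×ˢ (Set.univ : Set (S → Bool)), Y p
    have hX : X.Finite := (hG.finite.prod Set.finite_univ).biUnion fun p _ => hYf p
    have hYX : ∀ s ∈ Tu, ∀ σ : S → Bool, Y (s, σ) ⊆ X := fun s hs σ =>
      Set.subset_biUnion_of_mem (u := Y) (show (s, σ) ∈ S ×ˢ (Set.univ : Set (S → Bool)) from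
        ⟨hTS hs.1, Set.mem_univ _⟩)
    obtain ⟨p, e1, e2⟩ := (hG.pre X hX).exists_on (N := pieces S c X \ U) Set.sdiff_subset π
    have h1 : ∀ x ∈ U, p x = π x := fun x hx => e1 x fun h => h.2 hx
    have h2 : ∀ x ∈ pieces S c X, x ∉ U → HappyIn G (pieces S c X) p x :=
      fun x hx hxU => e2 x ⟨hx, hxU⟩
    have hadm : ∀ i ∈ X, Adm G S c U π (fun x => p x) i p := fun i hi =>
      adm_of_happyIn hG h1 h2 hi
    have hbig : ∀ s ∈ Tu, ∀ m, ℵ₀ ≤ m → (∃ i ∈ X, m ≤ #↥(G.neighborSet s ∩ piece S c i)) →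
        ∃ i ∈ X, m ≤ #↥(oppSet G p s ∩ piece S c i) := by
      rintro s hs m hm ⟨i, hi, hle⟩
      refine hG.exists_large_piece hX hm ?_
      refine (h2 s (Or.inl (hTS hs.1)) hs.1.1.2).le_opp hm (hle.trans (mk_le_mk_of_subset ?_))
      exact Set.inter_subset_inter_right _ (piece_subset_pieces hi)
    have hachp : ∀ s ∈ Tu, ∀ l < κ, (Ach G S c U π (fun x => p x) s l).Nonempty := by
      intro s hs l hlt
      by_contra hne
      obtain ⟨l', hl', he, i, hi, hli⟩ := (hY (s, fun x => p x) hs).2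
        ⟨l, hlt, Set.not_nonempty_iff_eq_empty.1 hne⟩
      obtain ⟨j, hj, hlj⟩ := hbig s hs (Order.succ l') (hl'.trans (Order.le_succ _))
        ⟨i, hYX s hs _ hi, Order.succ_le_of_lt hli⟩
      have hmem : j ∈ Ach G S c U π (fun x => p x) s l' :=
        ⟨p, hadm j hj, Order.succ_le_iff.1 hlj⟩
      rw [he] at hmem
      exact Set.notMem_empty j hmem
    have hcase : ∀ s ∈ Tu, (∃ i ∈ X, κ ≤ #↥(oppSet G p s ∩ piece S c i)) ∨
        ∀ i, #↥(G.neighborSet s ∩ piece S c i) < κ := by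
      intro s hs
      by_cases hi : ∃ i, κ ≤ #↥(G.neighborSet s ∩ piece S c i)
      · obtain ⟨i, hi, hle⟩ := (hY (s, fun x => p x) hs).1 hi
        exact Or.inl (hbig s hs κ hκ.le ⟨i, hYX s hs _ hi, hle⟩)
      · push Not at hi
        exact Or.inr hi
    -- colour `Tu` as in `p`, and the other vertices of `S` as provided by the induction
    obtain ⟨q, q1, q2⟩ := ih (U ∪ Tu) p (Set.ncard_lt_ncard
      ⟨Set.sdiff_subset_sdiff_right Set.subset_union_left, fun hsub =>
        (hsub hs₁.1.1).2 (Or.inr hs₁)⟩ (hG.finite.subset Set.sdiff_subset))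
    have hqU : ∀ x ∈ U, q x = π x := fun x hx => (q1 x (Or.inl hx)).trans (h1 x hx)
    -- the vertices where `p` and `q` differ have at most `lam < κ` neighbours in each piece
    have hdiff : ∀ i, ∀ s : S, q s ≠ p s → #↥(G.neighborSet s ∩ piece S c i) ≤ lam := by
      intro i s hne
      have hsU : s.1 ∉ U := fun h => hne (q1 s (Or.inl h))
      exact (hlam s ⟨s.2, hsU⟩).2 (fun h => hne (q1 s (Or.inr h))) i
    have hchange : ∀ i, ∀ ρ, Adm G S c U π (fun x => p x) i ρ → ∃ ρ',
        Adm G S c U π (fun x => q x) i ρ' ∧ ∀ s ∈ Tu, ∀ m, lam < m →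
          m ≤ #↥(oppSet G ρ s ∩ piece S c i) → m ≤ #↥(oppSet G ρ' s ∩ piece S c i) := by
      intro i ρ hρ
      obtain ⟨ρ', h3, h4⟩ := hρ.exists_adm_change hG hl (σ' := fun x => q x) (hdiff i)
      refine ⟨ρ', h3, fun s hs m hm hle => le_oppSet_inter_of_recolor hl hm hle ?_ ?_⟩
      · have hsS : s ∈ S := hTS hs.1
        rw [h3.bdry ⟨s, hsS⟩, hρ.bdry ⟨s, hsS⟩]
        exact q1 s (Or.inr hs)
      · refine (mk_le_mk_of_subset fun y hy => ?_).trans h4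
        exact ⟨hy.1, hy.2.2⟩
    have hρX : ∀ i, ∃ ρ', i ∈ X → Adm G S c U π (fun x => q x) i ρ' ∧ ∀ s ∈ Tu,
        κ ≤ #↥(oppSet G p s ∩ piece S c i) → κ ≤ #↥(oppSet G ρ' s ∩ piece S c i) := by
      intro i
      by_cases hi : i ∈ X
      · obtain ⟨ρ', h3, h4⟩ := hchange i p (hadm i hi)
        exact ⟨ρ', fun _ => ⟨h3, fun s hs => h4 s hs κ hlκ⟩⟩
      · exact ⟨p, fun h => absurd h hi⟩
    choose ρ' hρ' using hρX
    refine hfinish (fun x => q x) X ρ' hX (fun x hx => hqU x hx)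
      ⟨fun i hi => (hρ' i hi).1, fun s hs => ?_⟩
    by_cases hsu : s ∈ Tu
    · rcases hcase s hsu with ⟨i, hi, hle⟩ | hlt
      · exact Or.inl ⟨i, hi, (hρ' i hi).2 s hsu hle⟩
      · refine Or.inr (Or.inr ⟨hlt, fun l hlt' => ?_⟩)
        obtain ⟨i, ρ, h3, h4⟩ := hachp s hsu (max l lam) (max_lt hlt' hlκ)
        obtain ⟨ρ'', h5, h6⟩ := hchange i ρ h3
        refine ⟨i, ρ'', h5, (le_max_left l lam).trans_lt (Order.succ_le_iff.1 ?_)⟩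
        exact h6 s hsu _ ((le_max_right l lam).trans_lt (Order.lt_succ _))
          (Order.succ_le_of_lt h4)
    · -- `s` is happy in `q`, so it has opponents in `κ` pieces
      have hopp : κ ≤ #(oppSet G q s) := by
        have := (q2 s fun h => h.elim hs.1.2 hsu).le_oppSet (hs.2 ▸ hκ.le)
        rwa [hs.2] at this
      refine Or.inr (Or.inl ((hG.le_mk_pieces hκ.le hlκ hopp fun i => ?_).trans
        (mk_le_mk_of_subset fun i hi => ?_)))
      · exact (mk_le_mk_of_subset (Set.inter_subset_inter_left _ (oppSet_subset G q s))).trans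
          ((hlam s hs.1).2 hsu i)
      · refine ⟨q, ⟨fun _ => rfl, fun x _ hx => hqU x hx, fun x hx hxU => q2 x ?_⟩,
          pos_iff_ne_zero.2 ?_⟩
        · exact fun h => h.elim hxU fun h => hx.1 (hTS h.1)
        · exact mk_ne_zero_iff.2 (Set.nonempty_coe_sort.2 hi)

theorem IsGlued.prePartitionable (hG : IsGlued G S c) : PrePartitionable G := by
  classical
  have key : ∀ n, ∀ (U : Set V) (π : V → Bool), (S \ U).ncard = n → Extends G U π := by
    intro n
    induction n using Nat.strong_induction_on with
    | _ n ih =>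
      rintro U π rfl
      by_cases hd : ∀ s ∈ S \ U, #(G.neighborSet s) ≤ ℵ₀
      · exact hG.extends_of_countable U π hd
      · push Not at hd
        obtain ⟨s, hs, hlt⟩ := hd
        obtain ⟨s₀, hs₀, hmax⟩ := Set.exists_max_image (S \ U) (fun s => #(G.neighborSet s))
          (hG.finite.subset Set.sdiff_subset) ⟨s, hs⟩
        exact hG.extends_of_uncountable U π (fun U' π' h => ih _ h U' π' rfl)
          (hlt.trans_le (hmax s hs)) hmax hs₀ rfl
  intro U π
  obtain ⟨π', h1, h2⟩ := key _ U (fun x => if h : x ∈ U then π ⟨x, h⟩ else false) rfl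
  exact ⟨π', fun x => by rw [h1 x x.2]; simp, h2⟩

end Glued

end UnfriendlyPartition

theorem mainTheorem2 (𝒰 : UnfriendlyPartition.GraphClass.{u})
    (hclosed : UnfriendlyPartition.FinitelyClosed 𝒰)
    (hpre : ∀ (V : Type u) (G : SimpleGraph V),
      𝒰 V G → UnfriendlyPartition.PrePartitionable G) :
    ∀ (V : Type u) (G : SimpleGraph V),
      UnfriendlyPartition.Closure 𝒰 V G → UnfriendlyPartition.PrePartitionable G := by
  rintro V G ⟨μ, hμ⟩
  induction μ using WellFoundedLT.induction generalizing V with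
  | ind μ ih =>
    by_cases h0 : μ = 0
    · subst h0
      exact hpre V G (UnfriendlyPartition.level_zero.1 hμ)
    · obtain ⟨S, c, hS, hadj, hfin⟩ := hμ.exists_pieces hclosed h0
        (fun ν hν V G => ih ν hν V G)
      exact UnfriendlyPartition.IsGlued.prePartitionable (c := c) ⟨hS, hadj, hfin⟩
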